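/- **Setting.** Write $\mathbb{T}^d = \mathbb{R}^d/\mathbb{Z}^d$ and let $\mathrm{Leb}$ be its Lebesgue (Haar) probability measure. An *affine tori bundle* consists of integers $n, d \ge 1$, $\mathcal{C}^1$ manifolds (Hausdorff, second countable) $M$ and $\Omega$ of dimensions $n$ and $n+d$, a $\mathcal{C}^1$ map $\pi : \Omega \to M$, and an atlas of $\mathcal{C}^1$ diffeomorphisms $\psi_U : \pi^{-1}(U) \to U \times \mathbb{T}^d$ over open sets $U$ covering $M$, with $\mathrm{pr}_1 \circ \psi_U = \pi$, whose changes of charts have the form $(x,y) \mapsto (x, \alpha_{U,V}(x) + A_{U,V}\, y)$ with $\alpha_{U,V} : U \cap V \to \mathbb{T}^d$ of class $\mathcal{C}^1$ and $A_{U,V} \in \mathrm{GL}_d(\mathbb{Z})$. A flow $(g_t)_{t \in \mathbb{R}}$ on $\Omega$ is *compatible* if for every chart $\psi_U$ there is a continuous $v_U : U \to \mathbb{R}^d$ with $\psi_U \circ g_t \circ \psi_U^{-1}(x,y) = (x, y + t\,v_U(x))$ for all $t$. A measure $\mu$ on $\Omega$ is *compatible* if $(\psi_U)_*(\mu|_{\pi^{-1}(U)})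 = (\pi_*\mu)|_U \otimes \mathrm{Leb}$ for every chart $\psi_U$. The flow is *irrational over* $x \in M$ if $\langle \xi, v_U(x)\rangle \neq 0$ for all $\xi \in \mathbb{Z}^d \setminus \{0\}$ and every chart $\psi_U$ with $x \in U$ (this does not depend on the chart), that is, if it acts on $\pi^{-1}(x)$ by an irrational translation flow. A flow $(g_t)$ that preserves a probability measure $\mu$ is said to *exhibit Keplerian shear* if for every $f \in L^2(\Omega,\mu)$, $f \circ g_t \to \mathbb{E}_\mu(f \mid \mathcal{I})$ weakly in $L^2(\Omega,\mu)$ as $t \to +\infty$, where $\mathcal{I}$ is the $\sigma$-algebra of $(g_t)$-invariant measurable sets. **Theorem.** Let $\pi : \Omega \to M$ be an affine tori bundle with $\Omega$ compact, let $(g_t)_{t\in\mathbb{R}}$ be a compatible flow on $\Omega$, and let $\nu$ be a Borel probability measure on $M$. There is a unique compatible probability measure on $\Omega$ with image $\nu$ under $\pi$, denoted $\nu \otimes \mathrm{Leb}$. Let $\mathcal{P}_\nu$ be the space of Borel probability measures $\mu$ on $\Omega$ with $\pi_*\mu = \nu$, with the topology of weak convergence, and let $G_t := (g_t)_*$, which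 maps $\mathcal{P}_\nu$ to itself. The following are equivalent: 1. $(\Omega, \nu\otimes\mathrm{Leb}, (g_t))$ exhibits Keplerian shear, and the flow is irrational over $\nu$-almost every $x \in M$; 2. $G_t(\mu) \to \nu \otimes \mathrm{Leb}$ weakly as $t \to +\infty$, for every $\mu \in \mathcal{P}_\nu$. In that case $(\mathcal{P}_\nu, (G_t)_{t \in \mathbb{R}})$ is uniquely ergodic: there is exactly one $(G_t)$-invariant Borel probability measure on $\mathcal{P}_\nu$. -/

import Mathlib

open MeasureTheory Filter Topology Set
open scoped Manifold ContDiff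

noncomputable section

/-! ### The torus `𝕋^d = ℝ^d / ℤ^d` -/

/-- The `d`-dimensional torus `(ℝ/ℤ)^d`. Its `volume` is the Lebesgue (Haar) probability measure. -/
abbrev Torus (d : ℕ) : Type := Fin d → UnitAddCircle

/-- The covering map `ℝ^d → 𝕋^d`. -/
def torusProj {d : ℕ} (w : Fin d → ℝ) : Torus d := fun i => (w i : UnitAddCircle)

/-- The automorphism `y ↦ A y` of `𝕋^d` given by `A ∈ GL_d(ℤ)`. -/
def torusAut {d : ℕ} (A : Matrix.GeneralLinearGroup (Fin d) ℤ) (y : Torus d) : Torus d :=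
  fun i => ∑ j, (A : Matrix (Fin d) (Fin d) ℤ) i j • y j

/-! ### Affine tori bundles -/

/-- `α : M → 𝕋^d` is of class `C^1` on `s`: near each point of `s` it has a lift to `ℝ^d` which is
`C^1` there. -/
def IsC1IntoTorusOn {n d : ℕ} {M : Type*} [TopologicalSpace M]
    [ChartedSpace (EuclideanSpace ℝ (Fin n)) M] (α : M → Torus d) (s : Set M) : Prop :=
  ∀ x ∈ s, ∃ a : M → (Fin d → ℝ),
    ContMDiffAt (𝓡 n) 𝓘(ℝ, Fin d → ℝ) 1 a x ∧ ∀ᶠ z in 𝓝 x, α z = torusProj (a z)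

/-- An affine tori bundle structure on `π : Ω → M`, where `M` and `Ω` are `C^1` manifolds of
dimensions `n` and `n + d`: an atlas of local trivializations `ψ_U : π⁻¹(U) → U × 𝕋^d` which are
`C^1` diffeomorphisms, with structure group `𝕋^d ⋊ GL_d(ℤ)`.

A trivialization is in particular a homeomorphism `π⁻¹(U) ≃ U × 𝕋^d`; as `ℝ^d → 𝕋^d` is a covering
which defines the `C^1` structure of `𝕋^d`, it is a `C^1` diffeomorphism if and only if
`(x, w) ↦ ψ_U⁻¹(x, w mod ℤ^d)` is a `C^1` local diffeomorphism on `U × ℝ^d`. -/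
structure AffineToriBundle (n d : ℕ) {M Ω : Type*}
    [TopologicalSpace M] [ChartedSpace (EuclideanSpace ℝ (Fin n)) M]
    [TopologicalSpace Ω] [ChartedSpace (EuclideanSpace ℝ (Fin (n + d))) Ω]
    (π : Ω → M) where
  /-- the trivializing charts -/
  atlas : Set (Bundle.Trivialization (Torus d) π)
  contMDiff_proj : ContMDiff (𝓡 (n + d)) (𝓡 n) 1 π
  exists_mem_baseSet : ∀ x : M, ∃ e ∈ atlas, x ∈ e.baseSet
  diffeo : ∀ e ∈ atlas,
    IsLocalDiffeomorphOn ((𝓡 n).prod 𝓘(ℝ, Fin d → ℝ)) (𝓡 (n + d)) 1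
      (fun p : M × (Fin d → ℝ) => e.toOpenPartialHomeomorph.symm (p.1, torusProj p.2))
      (e.baseSet ×ˢ univ)
  change_of_charts : ∀ e ∈ atlas, ∀ e' ∈ atlas,
    ∃ (α : M → Torus d) (A : Matrix.GeneralLinearGroup (Fin d) ℤ),
      IsC1IntoTorusOn (n := n) α (e.baseSet ∩ e'.baseSet) ∧
      ∀ x ∈ e.baseSet ∩ e'.baseSet, ∀ y : Torus d,
        e' (e.toOpenPartialHomeomorph.symm (x, y)) = (x, α x + torusAut A y)

/-! ### Compatible flows and measures -/

section Chart

variable {d : ℕ} {M Ω : Type*} [TopologicalSpace M] [TopologicalSpace Ω] {π : Ω → M}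

/-- The flow `g` is compatible on the chart `ψ = e` over `U`, with velocity `v`:
`v` is continuous on `U`, and `ψ ∘ g_t ∘ ψ⁻¹ (x, y) = (x, y + t v(x))` for all `t`, `x ∈ U`, `y`. -/
def IsCompatibleOnWith (e : Bundle.Trivialization (Torus d) π) (g : Flow ℝ Ω)
    (v : M → (Fin d → ℝ)) : Prop :=
  ContinuousOn v e.baseSet ∧
  ∀ t : ℝ, ∀ x ∈ e.baseSet, ∀ y : Torus d,
    g t (e.toOpenPartialHomeomorph.symm (x, y)) ∈ e.source ∧
    e (g t (e.toOpenPartialHomeomorph.symm (x, y))) = (x, y + torusProj (t • v x))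

end Chart

namespace AffineToriBundle

variable {n d : ℕ} {M Ω : Type*}
  [TopologicalSpace M] [ChartedSpace (EuclideanSpace ℝ (Fin n)) M]
  [TopologicalSpace Ω] [ChartedSpace (EuclideanSpace ℝ (Fin (n + d))) Ω]
  {π : Ω → M}

/-- A flow is compatible if it is compatible on all charts. -/
def IsCompatibleFlow (B : AffineToriBundle n d π) (g : Flow ℝ Ω) : Prop :=
  ∀ e ∈ B.atlas, ∃ v : M → (Fin d → ℝ), IsCompatibleOnWith e g v

/-- A measure `μ` is compatible if `(ψ_U)_* (μ|π⁻¹(U)) = (π_* μ)|U ⊗ Leb` on all charts. -/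
def IsCompatibleMeasure [MeasurableSpace M] [MeasurableSpace Ω] (B : AffineToriBundle n d π)
    (μ : Measure Ω) : Prop :=
  ∀ e ∈ B.atlas,
    (μ.restrict (π ⁻¹' e.baseSet)).map e = ((μ.map π).restrict e.baseSet).prod volume

/-- The flow acts on the fibre over `x` by an irrational translation flow: in the charts over `x`,
its velocity satisfies no nontrivial linear relation with integer coefficients. -/
def IsIrrationalAt (B : AffineToriBundle n d π) (g : Flow ℝ Ω) (x : M) : Prop :=
  ∀ e ∈ B.atlas, x ∈ e.baseSet → ∀ v : M → (Fin d → ℝ), IsCompatibleOnWith e g v →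
    ∀ ξ : Fin d → ℤ, ξ ≠ 0 → ∑ i, (ξ i : ℝ) * v x i ≠ 0

/-- A compatible flow preserves each fibre. -/
theorem IsCompatibleFlow.proj_apply {B : AffineToriBundle n d π} {g : Flow ℝ Ω}
    (hg : B.IsCompatibleFlow g) (t : ℝ) (p : Ω) : π (g t p) = π p := by
  obtain ⟨e, he, hx⟩ := B.exists_mem_baseSet (π p)
  obtain ⟨v, -, hv⟩ := hg e he
  have hp : p ∈ e.source := e.mem_source.2 hx
  obtain ⟨h1, h2⟩ := hv t (π p) hx (e p).2
  have h3 : e.toOpenPartialHomeomorph.symm (π p, (e p).2) = p := by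
    rw [e.mk_proj_snd hp]
    exact e.toOpenPartialHomeomorph.left_inv hp
  rw [h3] at h1 h2
  rw [← e.coe_fst h1, h2]

end AffineToriBundle

/-! ### Keplerian shear -/

section Shear

variable {Ω : Type*} [MeasurableSpace Ω]

/-- The `σ`-algebra of measurable sets which are invariant under all the maps `g_t`. -/
abbrev invariantSigmaAlgebra (g : ℝ → Ω → Ω) : MeasurableSpace Ω :=
  ⨅ t : ℝ, MeasurableSpace.invariants (g t)

theorem invariantSigmaAlgebra_le (g : ℝ → Ω → Ω) :
    invariantSigmaAlgebra g ≤ ‹MeasurableSpace Ω› :=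
  (iInf_le _ 0).trans (MeasurableSpace.invariants_le _)

/-- `(Ω, μ, (g_t))` preserves `μ`, and for all `f ∈ L²(Ω, μ)`, `f ∘ g_t` converges to
`E_μ(f | 𝓘)` weakly in `L²(Ω, μ)` as `t → +∞`. -/
def KeplerianShear (μ : Measure Ω) (g : ℝ → Ω → Ω) : Prop :=
  ∃ hg : ∀ t, MeasurePreserving (g t) μ μ,
    ∀ f : Lp ℂ 2 μ,
      Tendsto (fun t : ℝ => toWeakSpace ℂ (Lp ℂ 2 μ) (Lp.compMeasurePreserving (g t) (hg t) f))
        atTop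
        (𝓝 (toWeakSpace ℂ (Lp ℂ 2 μ)
          ((condExpL2 ℂ ℂ (invariantSigmaAlgebra_le g) f :
            lpMeas ℂ ℂ (invariantSigmaAlgebra g) 2 μ) : Lp ℂ 2 μ)))

end Shear

/-! ### The action on measures with prescribed marginal, and unique ergodicity -/

section Measures

variable {M Ω : Type*} [MeasurableSpace M] [TopologicalSpace Ω] [MeasurableSpace Ω] [BorelSpace Ω]

/-- `𝒫_ν`, the set of probability measures `μ` on `Ω` such that `π_* μ = ν`. It is endowed with the
topology of weak convergence. -/
def prescribedMarginal (π : Ω → M) (ν : ProbabilityMeasure M) : Set (ProbabilityMeasure Ω) :=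
  {μ | (μ : Measure Ω).map π = (ν : Measure M)}

/-- `G_t = (g_t)_*`, acting on the probability measures on `Ω`. -/
def flowPush (g : Flow ℝ Ω) (t : ℝ) (μ : ProbabilityMeasure Ω) : ProbabilityMeasure Ω :=
  μ.map (f := g t) (g.continuous continuous_const continuous_id).measurable.aemeasurable

end Measures

/-- The family `(G_t)` of self-maps of the topological space `X` is uniquely ergodic: there is
exactly one `(G_t)`-invariant Borel probability measure on `X`. -/
def IsUniquelyErgodic {X : Type*} [TopologicalSpace X] (G : ℝ → X → X) : Prop :=
  letI : MeasurableSpace X := borel X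
  ∃! m : Measure X, IsProbabilityMeasure m ∧ ∀ t, MeasurePreserving (G t) m m

namespace AffineToriBundle

variable {n d : ℕ} {M Ω : Type*}
  [TopologicalSpace M] [ChartedSpace (EuclideanSpace ℝ (Fin n)) M]
  [MeasurableSpace M] [BorelSpace M]
  [TopologicalSpace Ω] [ChartedSpace (EuclideanSpace ℝ (Fin (n + d))) Ω]
  [MeasurableSpace Ω] [BorelSpace Ω]
  {π : Ω → M}

theorem IsCompatibleFlow.mapsTo {B : AffineToriBundle n d π} {g : Flow ℝ Ω}
    (hg : B.IsCompatibleFlow g) (ν : ProbabilityMeasure M) (t : ℝ) :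
    MapsTo (flowPush g t) (prescribedMarginal π ν) (prescribedMarginal π ν) := by
  intro μ hμ
  have hπ : Measurable π := B.contMDiff_proj.continuous.measurable
  have hgt : Measurable (g t) := (g.continuous continuous_const continuous_id).measurable
  have hcomp : π ∘ g t = π := funext (hg.proj_apply t)
  change ((μ : Measure Ω).map (g t)).map π = (ν : Measure M)
  rw [Measure.map_map hπ hgt, hcomp]
  exact hμ

/-- The maps `G_t : 𝒫_ν → 𝒫_ν`. -/
def actionOnMarginal {B : AffineToriBundle n d π} {g : Flow ℝ Ω}
    (hg : B.IsCompatibleFlow g) (ν : ProbabilityMeasure M) (t : ℝ) :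
    prescribedMarginal π ν → prescribedMarginal π ν :=
  (hg.mapsTo ν t).restrict

end AffineToriBundle

end

/-! The measure `ν ⊗ Leb` is glued from products `ν|D × Leb` over a finite measurable partition of
the base into chart pieces. The changes of charts are skew translations composed with automorphisms
of the torus, so they preserve Haar measure on each fibre and the gluing does not depend on the
chart.

From convergence to shear (`keplerianShear_of_tendsto`). Write `μ = ν ⊗ Leb`. For a measurable set
`S`, the density `1 + 1_S - E(1_S | 𝓘)` is nonnegative and has the same marginal as `μ`, because
preimages of sets of `M` are invariant. Pushing it by `g_t`, only the term in `1_S` depends on time,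
since `μ` and `E(1_S | 𝓘)` are invariant. Convergence to `μ` therefore says exactly that `∫_S f ∘
g_t` tends to `∫ E(1_S | 𝓘) f` for continuous `f`. Density in `L²` and self-adjointness of the
conditional expectation do the rest.

From convergence to irrationality (`measure_resonance_eq_zero`). Over a set `E` on which `⟨ξ, v⟩ =
0`, the character `ξ` is constant along orbits. Concentrating the fibre measures over `E` at one
point gives a measure whose integral against a suitable multiple of that character is constant in
time and nonzero if `ν E > 0`, whereas the limit must be zero.

From shear and irrationality to convergence (`tendsto_flowPush`). In a chart a fibre character is
multiplied by `exp(2πi t⟨ξ, v⟩)` under the flow. Its weak limit is unchanged by a shift of time, so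
it is fixed by all these multipliers and vanishes where `⟨ξ, v⟩ ≠ 0`, which is almost everywhere.
The result is a Riemann–Lebesgue statement on the base: `∫ ψ exp(2πi t⟨ξ, v⟩) dν → 0` for bounded
`ψ`. Disintegrating an arbitrary `μ` along the fibres, its fibre Fourier coefficients serve as `ψ`,
and trigonometric polynomials are dense (`tendsto_integral_translate`).

Unique ergodicity is soft: when every point converges to one fixed point, dominated convergence
forces an invariant measure to be the Dirac mass there. -/

noncomputable section

/-! ### Characters and automorphisms of the torus -/

section Torus

variable {d : ℕ}

instance isProbabilityMeasure_volume_unitAddCircle :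
    IsProbabilityMeasure (volume : Measure UnitAddCircle) :=
  ⟨UnitAddCircle.measure_univ⟩

theorem continuous_torusProj : Continuous (torusProj : (Fin d → ℝ) → Torus d) :=
  continuous_pi fun i => (AddCircle.continuous_mk' 1).comp (continuous_apply i)

theorem continuous_torusAut (A : Matrix.GeneralLinearGroup (Fin d) ℤ) :
    Continuous (torusAut A : Torus d → Torus d) :=
  continuous_pi fun _ => continuous_finsetSum _ fun j _ => (continuous_apply j).zsmul _

theorem torusAut_mul (A B : Matrix.GeneralLinearGroup (Fin d) ℤ) (y : Torus d) :
    torusAut (A * B) y = torusAut A (torusAut B y) := by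
  ext i
  simp only [torusAut, Units.val_mul, Matrix.mul_apply, Finset.sum_smul, Finset.smul_sum, mul_smul]
  exact Finset.sum_comm

theorem torusAut_one (y : Torus d) : torusAut 1 y = y := by
  ext i
  simp [torusAut, Matrix.one_apply, ite_smul]

theorem torusAut_add (A : Matrix.GeneralLinearGroup (Fin d) ℤ) (y z : Torus d) :
    torusAut A (y + z) = torusAut A y + torusAut A z := by
  ext i
  simp [torusAut, smul_add, Finset.sum_add_distrib]

theorem torusAut_torusProj (A : Matrix.GeneralLinearGroup (Fin d) ℤ) (w : Fin d → ℝ) :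
    torusAut A (torusProj w) =
      torusProj fun i => ∑ j, ((A : Matrix (Fin d) (Fin d) ℤ) i j : ℝ) * w j := by
  ext i
  simp only [torusAut, torusProj]
  rw [show ((∑ j, ((A : Matrix (Fin d) (Fin d) ℤ) i j : ℝ) * w j : ℝ) : UnitAddCircle)
    = ∑ j, ((((A : Matrix (Fin d) (Fin d) ℤ) i j : ℝ) * w j : ℝ) : UnitAddCircle) from
      map_sum (QuotientAddGroup.mk' (AddSubgroup.zmultiples (1 : ℝ))) _ _]
  refine Finset.sum_congr rfl fun j _ => ?_
  rw [← zsmul_eq_mul, AddCircle.coe_zsmul]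

theorem measurePreserving_torusAut (A : Matrix.GeneralLinearGroup (Fin d) ℤ) :
    MeasurePreserving (torusAut A : Torus d → Torus d) := by
  refine AddMonoidHom.measurePreserving (f := AddMonoidHom.mk' (torusAut A) (torusAut_add A))
    (continuous_torusAut A) (fun y => ⟨torusAut A⁻¹ y, ?_⟩) rfl
  change torusAut A (torusAut A⁻¹ y) = y
  rw [← torusAut_mul, mul_inv_cancel, torusAut_one]

theorem mFourier_apply_add (ξ : Fin d → ℤ) (y z : Torus d) :
    UnitAddTorus.mFourier ξ (y + z) = UnitAddTorus.mFourier ξ y * UnitAddTorus.mFourier ξ z := by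
  simp [UnitAddTorus.mFourier, Finset.prod_mul_distrib, fourier_apply, smul_add,
    AddCircle.toCircle_add]

theorem norm_mFourier_apply (ξ : Fin d → ℤ) (y : Torus d) :
    ‖UnitAddTorus.mFourier ξ y‖ = 1 := by
  simp only [UnitAddTorus.mFourier, ContinuousMap.coe_mk, fourier_apply, norm_prod]
  exact Finset.prod_eq_one fun _ _ => Circle.norm_coe _

theorem mFourier_torusProj (ξ : Fin d → ℤ) (w : Fin d → ℝ) :
    UnitAddTorus.mFourier ξ (torusProj w) =
      Complex.exp (2 * Real.pi * Complex.I * (∑ i, (ξ i : ℝ) * w i : ℝ)) := by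
  simp only [UnitAddTorus.mFourier, ContinuousMap.coe_mk, torusProj, fourier_coe_apply,
    ← Complex.exp_sum]
  push_cast
  rw [Finset.mul_sum]
  congr 1
  refine Finset.sum_congr rfl fun i _ => by simp; ring

theorem integral_mFourier_eq_zero {ξ : Fin d → ℤ} (hξ : ξ ≠ 0) :
    ∫ y : Torus d, UnitAddTorus.mFourier ξ y = 0 := by
  obtain ⟨i, hi⟩ := Function.ne_iff.1 hξ
  have hi' : (ξ i : ℝ) ≠ 0 := by exact_mod_cast hi
  -- Translation by half a period in a coordinate where `ξ` is nonzero changes the sign of the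
  -- character, so its integral equals its own opposite.
  set z : Torus d := torusProj (Pi.single i (1 / (2 * (ξ i : ℝ))))
  have hz : UnitAddTorus.mFourier ξ z = -1 := by
    rw [mFourier_torusProj, Finset.sum_eq_single i (fun j _ hj => by simp [hj]) (by simp),
      Pi.single_eq_same, ← Complex.exp_pi_mul_I]
    congr 1
    have : (ξ i : ℂ) ≠ 0 := by exact_mod_cast hi
    push_cast
    field_simp
  have h := integral_add_right_eq_self (μ := (volume : Measure (Torus d)))
    (fun y => UnitAddTorus.mFourier ξ y) z
  simp only [mFourier_apply_add, hz, mul_neg, mul_one, integral_neg] at h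
  exact self_eq_neg.1 h.symm

/-- If `w i ≠ 0`, the time `1 / (2 * w i)` sends coordinate `i` to the class of `1/2`, which is not
zero. This lets velocities in different charts be compared through the flows they generate. -/
theorem eq_zero_of_torusProj_smul {w : Fin d → ℝ}
    (h : ∀ t : ℝ, torusProj (t • w) = (0 : Torus d)) : w = 0 := by
  ext i
  by_contra hi
  have h1 := congrFun (h (1 / (2 * w i))) i
  simp only [torusProj, Pi.smul_apply, smul_eq_mul, Pi.zero_apply] at h1
  obtain ⟨k, hk⟩ := (AddCircle.coe_eq_zero_iff 1).1 h1
  have hi' : w i ≠ 0 := hi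
  have : (2 * k : ℝ) = 1 := by
    rw [zsmul_eq_mul, mul_one] at hk
    rw [hk]; field_simp
  have : (2 * k : ℤ) = 1 := by exact_mod_cast this
  omega

end Torus

/-! ### Measurable coordinates in a chart -/

section ChartCoord

variable {d : ℕ} {M Ω : Type*} [TopologicalSpace M] [TopologicalSpace Ω] {π : Ω → M}

open Classical in
/-- The chart `e`, extended to a map defined on all of `Ω` with first component `π`. -/
def chartCoord (e : Bundle.Trivialization (Torus d) π) (p : Ω) : M × Torus d :=
  (π p, if p ∈ π ⁻¹' e.baseSet then (e p).2 else 0)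

open Classical in
/-- The inverse of the chart `e`, with value `p₀` outside the domain of the chart. -/
def chartInv (e : Bundle.Trivialization (Torus d) π) (p₀ : Ω) (q : M × Torus d) : Ω :=
  if q ∈ e.baseSet ×ˢ (univ : Set (Torus d)) then e.toOpenPartialHomeomorph.symm q else p₀

theorem chartCoord_eq (e : Bundle.Trivialization (Torus d) π) {p : Ω} (hp : π p ∈ e.baseSet) :
    chartCoord e p = e p := by
  rw [chartCoord, if_pos (mem_preimage.2 hp), e.mk_proj_snd' hp]

theorem chartInv_eq (e : Bundle.Trivialization (Torus d) π) (p₀ : Ω) {x : M} (hx : x ∈ e.baseSet)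
    (y : Torus d) : chartInv e p₀ (x, y) = e.toOpenPartialHomeomorph.symm (x, y) :=
  if_pos ⟨hx, mem_univ _⟩

theorem proj_chartInv (e : Bundle.Trivialization (Torus d) π) (p₀ : Ω) {x : M}
    (hx : x ∈ e.baseSet) (y : Torus d) : π (chartInv e p₀ (x, y)) = x := by
  rw [chartInv_eq e p₀ hx]
  exact e.proj_symm_apply' hx

theorem chartInv_chartCoord (e : Bundle.Trivialization (Torus d) π) (p₀ : Ω) {p : Ω}
    (hp : π p ∈ e.baseSet) : chartInv e p₀ (chartCoord e p) = p := by
  rw [chartCoord_eq e hp, ← e.mk_proj_snd' hp, chartInv_eq e p₀ hp, e.mk_proj_snd' hp]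
  exact e.toOpenPartialHomeomorph.left_inv (e.mem_source.2 hp)

theorem chartCoord_chartInv (e : Bundle.Trivialization (Torus d) π) (p₀ : Ω) {x : M}
    (hx : x ∈ e.baseSet) (y : Torus d) : chartCoord e (chartInv e p₀ (x, y)) = (x, y) := by
  rw [chartCoord_eq e (by rwa [proj_chartInv e p₀ hx]), chartInv_eq e p₀ hx]
  exact e.apply_symm_apply' hx

variable [MeasurableSpace M] [BorelSpace M] [MeasurableSpace Ω]

/-- A trivialization carries no information outside its source, so its global measurability is
unavailable; `chartCoord` is a globally measurable substitute that agrees with it over the base set.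
-/
theorem restrict_map_eq_map_chartCoord (hπ : Measurable π)
    (e : Bundle.Trivialization (Torus d) π) (μ : Measure Ω) :
    (μ.restrict (π ⁻¹' e.baseSet)).map e = (μ.restrict (π ⁻¹' e.baseSet)).map (chartCoord e) :=
  Measure.map_congr <| (ae_restrict_iff' (hπ e.open_baseSet.measurableSet)).2 <|
    Eventually.of_forall fun _ hp => (chartCoord_eq e hp).symm

variable [BorelSpace Ω]

theorem measurable_chartCoord (hπ : Measurable π) (e : Bundle.Trivialization (Torus d) π) :
    Measurable (chartCoord e) := by
  classical
  refine hπ.prodMk ?_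
  have h : ContinuousOn (fun p => (e p).2) (π ⁻¹' e.baseSet) := by
    rw [← e.source_eq]
    exact continuous_snd.comp_continuousOn e.continuousOn_toFun
  exact h.measurable_piecewise continuousOn_const (hπ e.open_baseSet.measurableSet)

theorem measurable_chartInv (e : Bundle.Trivialization (Torus d) π) (p₀ : Ω) :
    Measurable (chartInv e p₀) := by
  classical
  have h : ContinuousOn e.toOpenPartialHomeomorph.symm (e.baseSet ×ˢ (univ : Set (Torus d))) := by
    rw [← e.target_eq]
    exact e.continuousOn_invFun
  exact h.measurable_piecewise continuousOn_const
    (e.open_baseSet.measurableSet.prod MeasurableSet.univ)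

end ChartCoord

/-! ### The compatible measure with prescribed marginal: uniqueness and existence. -/

namespace AffineToriBundle

variable {n d : ℕ} {M Ω : Type*}
  [TopologicalSpace M] [ChartedSpace (EuclideanSpace ℝ (Fin n)) M]
  [TopologicalSpace Ω] [ChartedSpace (EuclideanSpace ℝ (Fin (n + d))) Ω]
  {π : Ω → M}

theorem surjective (B : AffineToriBundle n d π) : Function.Surjective π := fun x => by
  obtain ⟨e, -, hx⟩ := B.exists_mem_baseSet x
  exact ⟨e.toOpenPartialHomeomorph.symm (x, 0), e.proj_symm_apply' hx⟩

theorem compactSpace_base [CompactSpace Ω] (B : AffineToriBundle n d π) : CompactSpace M :=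
  B.surjective.compactSpace B.contMDiff_proj.continuous

variable [MeasurableSpace M] [BorelSpace M]

/-- The base is a finite disjoint union of measurable sets, each in the domain of a chart. -/
theorem exists_finite_partition [CompactSpace M] (B : AffineToriBundle n d π) :
    ∃ (N : ℕ) (e : Fin N → Bundle.Trivialization (Torus d) π) (D : Fin N → Set M),
      (∀ i, e i ∈ B.atlas) ∧ (∀ i, MeasurableSet (D i)) ∧ (∀ i, D i ⊆ (e i).baseSet) ∧
      Pairwise (Function.onFun Disjoint D) ∧ ⋃ i, D i = univ := by
  choose e he hx using B.exists_mem_baseSet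
  obtain ⟨t, ht⟩ := isCompact_univ.elim_finite_subcover (fun x => (e x).baseSet)
    (fun x => (e x).open_baseSet) fun x _ => mem_iUnion.2 ⟨x, hx x⟩
  let f : Fin t.card → Bundle.Trivialization (Torus d) π := fun i => e (t.equivFin.symm i)
  refine ⟨t.card, f, disjointed fun i => (f i).baseSet, fun i => he _,
    fun i => ?_,
    fun i => disjointed_subset _ i, disjoint_disjointed _, ?_⟩
  · rw [disjointed_apply, Finset.sup_set_eq_biUnion]
    exact (f i).open_baseSet.measurableSet.diff <|
      Finset.measurableSet_biUnion _ fun j _ => (f j).open_baseSet.measurableSet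
  rw [iUnion_disjointed, eq_univ_iff_forall]
  intro x
  obtain ⟨z, hz, hxz⟩ := mem_iUnion₂.1 (ht (mem_univ x))
  exact mem_iUnion.2 ⟨t.equivFin ⟨z, hz⟩, by simpa [f] using hxz⟩

variable [MeasurableSpace Ω] [BorelSpace Ω]

theorem measurable_proj (B : AffineToriBundle n d π) : Measurable π :=
  B.contMDiff_proj.continuous.measurable

theorem IsCompatibleMeasure.map_chartCoord {B : AffineToriBundle n d π} {μ : Measure Ω} [SFinite μ]
    (hμ : B.IsCompatibleMeasure μ) {e : Bundle.Trivialization (Torus d) π} (he : e ∈ B.atlas)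
    {A : Set M} (hA : MeasurableSet A) (hAe : A ⊆ e.baseSet) :
    (μ.restrict (π ⁻¹' A)).map (chartCoord e) = ((μ.map π).restrict A).prod volume := by
  have h := hμ e he
  rw [restrict_map_eq_map_chartCoord B.measurable_proj] at h
  have h2 := congrArg (fun m => m.restrict (A ×ˢ (univ : Set (Torus d)))) h
  rw [Measure.restrict_map (measurable_chartCoord B.measurable_proj e)
    (hA.prod MeasurableSet.univ), ← Measure.prod_restrict, Measure.restrict_restrict hA,
    Measure.restrict_univ, inter_eq_left.2 hAe] at h2
  rw [← h2, show chartCoord e ⁻¹' (A ×ˢ univ) = π ⁻¹' A by ext; simp [chartCoord],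
    Measure.restrict_restrict (B.measurable_proj hA),
    inter_eq_left.2 (preimage_mono hAe)]

theorem IsCompatibleMeasure.restrict_eq {B : AffineToriBundle n d π} {μ : Measure Ω} [SFinite μ]
    (hμ : B.IsCompatibleMeasure μ) {e : Bundle.Trivialization (Torus d) π} (he : e ∈ B.atlas)
    (p₀ : Ω) {A : Set M} (hA : MeasurableSet A) (hAe : A ⊆ e.baseSet) :
    μ.restrict (π ⁻¹' A) = (((μ.map π).restrict A).prod volume).map (chartInv e p₀) := by
  rw [← hμ.map_chartCoord he hA hAe, Measure.map_map (measurable_chartInv e p₀)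
    (measurable_chartCoord B.measurable_proj e)]
  conv_lhs => rw [← Measure.map_id (μ := μ.restrict (π ⁻¹' A))]
  refine Measure.map_congr <| (ae_restrict_iff' (B.measurable_proj hA)).2 <|
    Eventually.of_forall fun p hp => ?_
  exact (chartInv_chartCoord e p₀ (hAe hp)).symm

/-- Over each piece of the partition, a compatible measure is the image under the inverse chart of a
product determined by its marginal. -/
theorem IsCompatibleMeasure.eq_of_map_eq [CompactSpace M] {B : AffineToriBundle n d π}
    {μ₁ μ₂ : Measure Ω} [SFinite μ₁] [SFinite μ₂] (h₁ : B.IsCompatibleMeasure μ₁)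
    (h₂ : B.IsCompatibleMeasure μ₂) (h : μ₁.map π = μ₂.map π) : μ₁ = μ₂ := by
  obtain ⟨N, e, D, he, hD, hDe, -, hDu⟩ := B.exists_finite_partition
  have hu : ⋃ i, π ⁻¹' D i = univ := by rw [← preimage_iUnion, hDu, preimage_univ]
  refine Measure.ext_of_iUnion_eq_univ hu fun i => ?_
  rcases isEmpty_or_nonempty Ω with _ | ⟨⟨p₀⟩⟩
  · exact Measure.ext fun s _ => by simp [Set.eq_empty_of_isEmpty s]
  · rw [h₁.restrict_eq (he i) p₀ (hD i) (hDe i), h₂.restrict_eq (he i) p₀ (hD i) (hDe i), h]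

/-- The product measure on one chart is the product measure on the other ones. -/
theorem map_chartInv_restrict_map (B : AffineToriBundle n d π)
    {e e' : Bundle.Trivialization (Torus d) π} (he : e ∈ B.atlas) (he' : e' ∈ B.atlas) (p₀ : Ω)
    {A : Set M} (hA : MeasurableSet A) (hAe : A ⊆ e.baseSet) (ν : Measure M) [SFinite ν] :
    ((((ν.restrict A).prod volume).map (chartInv e p₀)).restrict (π ⁻¹' e'.baseSet)).map
      (chartCoord e') = (ν.restrict (A ∩ e'.baseSet)).prod volume := by
  classical
  have hU := e'.open_baseSet.measurableSet
  have hinv := measurable_chartInv e p₀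
  have hc := measurable_chartCoord B.measurable_proj e'
  have hAU := hA.inter hU
  obtain ⟨α, a, -, hα⟩ := B.change_of_charts e he e' he'
  have h1 : ((ν.restrict A).prod volume).restrict (chartInv e p₀ ⁻¹' (π ⁻¹' e'.baseSet)) =
      (ν.restrict (A ∩ e'.baseSet)).prod (volume : Measure (Torus d)) := by
    conv_rhs => rw [inter_comm, ← Measure.restrict_restrict hU, ← Measure.restrict_univ
      (μ := (volume : Measure (Torus d))), Measure.prod_restrict]
    refine Measure.restrict_congr_set ?_
    have : ∀ᵐ q ∂((ν.restrict A).prod (volume : Measure (Torus d))), q.1 ∈ A :=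
      Measure.quasiMeasurePreserving_fst.ae (ae_restrict_mem hA)
    filter_upwards [this] with q hq
    refine propext ?_
    change π (chartInv e p₀ (q.1, q.2)) ∈ e'.baseSet ↔ q ∈ e'.baseSet ×ˢ univ
    rw [proj_chartInv e p₀ (hAe hq)]
    simp
  rw [Measure.restrict_map hinv (B.measurable_proj hU), h1, Measure.map_map hc hinv]
  -- The fibre component of the change of charts, extended by the identity. Its joint measurability
  -- comes from the charts themselves, because nothing is known of `α` outside the overlap.
  let G : M → Torus d → Torus d := fun x y =>
    if x ∈ A ∩ e'.baseSet then (chartCoord e' (chartInv e p₀ (x, y))).2 else y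
  have hG : ∀ x ∈ A ∩ e'.baseSet, ∀ y, chartCoord e' (chartInv e p₀ (x, y)) = (x, G x y) ∧
      G x y = α x + torusAut a y := by
    intro x hx y
    have h2 : chartCoord e' (chartInv e p₀ (x, y)) = (x, α x + torusAut a y) := by
      rw [chartCoord_eq e' (by rw [proj_chartInv e p₀ (hAe hx.1)]; exact hx.2),
        chartInv_eq e p₀ (hAe hx.1), hα x ⟨hAe hx.1, hx.2⟩]
    simp only [G, if_pos hx, h2, and_self]
  have hGm : Measurable (Function.uncurry G) :=
    Measurable.ite (measurable_fst hAU) (measurable_snd.comp (hc.comp hinv)) measurable_snd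
  have h3 : MeasurePreserving (fun q : M × Torus d => (id q.1, G q.1 q.2))
      ((ν.restrict (A ∩ e'.baseSet)).prod volume)
      ((ν.restrict (A ∩ e'.baseSet)).prod volume) := by
    -- On almost every fibre `G x` is an automorphism followed by a translation, and both preserve
    -- Haar measure.
    refine (MeasurePreserving.id _).skew_product hGm ?_
    filter_upwards [ae_restrict_mem hAU] with x hx
    have : G x = fun y => α x + torusAut a y := funext fun y => (hG x hx y).2
    rw [this]
    exact ((measurePreserving_torusAut a).add_left _ (α x)).map_eq
  conv_rhs => rw [← h3.map_eq]
  refine Measure.map_congr ?_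
  have : ∀ᵐ q ∂((ν.restrict (A ∩ e'.baseSet)).prod (volume : Measure (Torus d))),
      q.1 ∈ A ∩ e'.baseSet := Measure.quasiMeasurePreserving_fst.ae (ae_restrict_mem hAU)
  filter_upwards [this] with q hq
  exact (hG q.1 hq q.2).1

theorem exists_isCompatibleMeasure [CompactSpace M] (B : AffineToriBundle n d π)
    (ν : Measure M) [IsProbabilityMeasure ν] :
    ∃ μ : Measure Ω, IsProbabilityMeasure μ ∧ μ.map π = ν ∧ B.IsCompatibleMeasure μ := by
  obtain ⟨N, e, D, he, hD, hDe, hDd, hDu⟩ := B.exists_finite_partition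
  obtain ⟨x₀⟩ := ν.nonempty_of_neZero
  obtain ⟨p₀, -⟩ := B.surjective x₀
  have hπ := B.measurable_proj
  set μ : Measure Ω :=
    Measure.sum fun i => ((ν.restrict (D i)).prod volume).map (chartInv (e i) p₀)
  have hν : ∀ A : Set M, MeasurableSet A →
      Measure.sum (fun i => ν.restrict (D i ∩ A)) = ν.restrict A := by
    intro A hA
    rw [← Measure.restrict_iUnion (fun i j hij => (hDd hij).mono inter_subset_left
      inter_subset_left) (fun i => (hD i).inter hA), ← iUnion_inter, hDu, univ_inter]
  have hμ : μ.map π = ν := by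
    rw [Measure.map_sum hπ.aemeasurable]
    conv_rhs => rw [← Measure.restrict_univ (μ := ν), ← hν univ MeasurableSet.univ]
    congr 1
    ext1 i
    rw [Measure.map_map hπ (measurable_chartInv _ _), inter_univ]
    have h1 : ((ν.restrict (D i)).prod volume).map (π ∘ chartInv (e i) p₀) =
        ((ν.restrict (D i)).prod (volume : Measure (Torus d))).map Prod.fst := by
      refine Measure.map_congr ?_
      have : ∀ᵐ q ∂((ν.restrict (D i)).prod (volume : Measure (Torus d))), q.1 ∈ D i :=
        Measure.quasiMeasurePreserving_fst.ae (ae_restrict_mem (hD i))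
      filter_upwards [this] with q hq
      exact proj_chartInv (e i) p₀ (hDe i hq) q.2
    rw [h1, Measure.map_fst_prod, measure_univ, one_smul]
  refine ⟨μ, ?_, hμ, fun e' he' => ?_⟩
  · have : IsProbabilityMeasure (μ.map π) := hμ ▸ inferInstance
    exact Measure.isProbabilityMeasure_of_map π
  · have hU := e'.open_baseSet.measurableSet
    rw [hμ, restrict_map_eq_map_chartCoord hπ, Measure.restrict_sum _ (hπ hU),
      Measure.map_sum (measurable_chartCoord hπ e').aemeasurable, ← hν _ hU]
    simp_rw [B.map_chartInv_restrict_map (he _) he' p₀ (hD _) (hDe _) ν]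
    rw [Measure.prod_sum_left]

/-- The measure `ν ⊗ Leb` is well defined. -/
theorem existsUnique_isCompatibleMeasure [CompactSpace M] (B : AffineToriBundle n d π)
    (ν : ProbabilityMeasure M) :
    ∃! μ : ProbabilityMeasure Ω,
      μ ∈ prescribedMarginal π ν ∧ B.IsCompatibleMeasure (μ : Measure Ω) := by
  obtain ⟨μ, hμ, hμν, hμc⟩ := B.exists_isCompatibleMeasure (ν : Measure M)
  refine ⟨⟨μ, hμ⟩, ⟨hμν, hμc⟩, fun μ' h => Subtype.ext ?_⟩
  exact h.2.eq_of_map_eq hμc (Eq.trans h.1 hμν.symm)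

end AffineToriBundle

/-! ### Compatible flows in coordinates -/

section Chart

variable {d : ℕ} {M Ω : Type*} [TopologicalSpace M] [TopologicalSpace Ω] {π : Ω → M}
  {e : Bundle.Trivialization (Torus d) π} {g : Flow ℝ Ω} {v : M → (Fin d → ℝ)}

theorem IsCompatibleOnWith.chartCoord_apply (h : IsCompatibleOnWith e g v) (t : ℝ) {p : Ω}
    (hp : π p ∈ e.baseSet) :
    chartCoord e (g t p) = (π p, (chartCoord e p).2 + torusProj (t • v (π p))) := by
  obtain ⟨h1, h2⟩ := h.2 t (π p) hp (e p).2
  have h3 : e.toOpenPartialHomeomorph.symm (π p, (e p).2) = p := by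
    rw [e.mk_proj_snd' hp]
    exact e.toOpenPartialHomeomorph.left_inv (e.mem_source.2 hp)
  rw [h3] at h1 h2
  rw [chartCoord_eq e (e.mem_source.1 h1), chartCoord_eq e hp, h2]

theorem IsCompatibleOnWith.congr {w : M → (Fin d → ℝ)} (h : IsCompatibleOnWith e g v)
    (hw : EqOn w v e.baseSet) : IsCompatibleOnWith e g w :=
  ⟨h.1.congr hw, fun t x hx y => by rw [hw hx]; exact h.2 t x hx y⟩

end Chart

namespace AffineToriBundle

variable {n d : ℕ} {M Ω : Type*}
  [TopologicalSpace M] [ChartedSpace (EuclideanSpace ℝ (Fin n)) M]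
  [TopologicalSpace Ω] [ChartedSpace (EuclideanSpace ℝ (Fin (n + d))) Ω]
  {π : Ω → M} {B : AffineToriBundle n d π} {g : Flow ℝ Ω}

/-- The velocities in two charts differ by an element of `GL_d(ℤ)`. -/
theorem exists_velocity_eq (B : AffineToriBundle n d π) {e e' : Bundle.Trivialization (Torus d) π}
    (he : e ∈ B.atlas) (he' : e' ∈ B.atlas) {v v' : M → (Fin d → ℝ)}
    (hv : IsCompatibleOnWith e g v) (hv' : IsCompatibleOnWith e' g v') :
    ∃ A : Matrix.GeneralLinearGroup (Fin d) ℤ, ∀ x ∈ e.baseSet ∩ e'.baseSet,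
      v' x = fun i => ∑ j, ((A : Matrix (Fin d) (Fin d) ℤ) i j : ℝ) * v x j := by
  obtain ⟨α, A, -, hα⟩ := B.change_of_charts e he e' he'
  have hch : ∀ p : Ω, π p ∈ e.baseSet → π p ∈ e'.baseSet →
      (chartCoord e' p).2 = α (π p) + torusAut A (chartCoord e p).2 := by
    intro p hp hp'
    have h := hα (π p) ⟨hp, hp'⟩ (chartCoord e p).2
    rw [show (π p, (chartCoord e p).2) = chartCoord e p from rfl, chartCoord_eq e hp,
      show e.toOpenPartialHomeomorph.symm (e p) = p from
        e.toOpenPartialHomeomorph.left_inv (e.mem_source.2 hp)] at h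
    rw [chartCoord_eq e' hp', h, chartCoord_eq e hp]
  refine ⟨A, fun x hx => ?_⟩
  obtain ⟨p, rfl⟩ := B.surjective x
  rw [← sub_eq_zero]
  -- Computing `g t p` in the second chart directly, and through the change of charts, gives two
  -- translations of the same point; the term `α` cancels.
  refine eq_zero_of_torusProj_smul fun t => ?_
  have hgp : π (g t p) = π p := congrArg Prod.fst (hv.chartCoord_apply t hx.1)
  have h1 := hch (g t p) (by rw [hgp]; exact hx.1) (by rw [hgp]; exact hx.2)
  rw [hv.chartCoord_apply t hx.1, hv'.chartCoord_apply t hx.2, hgp, hch p hx.1 hx.2] at h1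
  simp only [torusAut_add, torusAut_torusProj, add_assoc, add_right_inj] at h1
  ext i
  have h2 := congrFun h1 i
  simp only [torusProj, Pi.smul_apply, smul_eq_mul] at h2
  simp only [torusProj, Pi.smul_apply, Pi.sub_apply, smul_eq_mul, mul_sub, AddCircle.coe_sub,
    Pi.zero_apply, sub_eq_zero]
  rw [h2, Finset.mul_sum]
  congr 1
  exact Finset.sum_congr rfl fun j _ => by ring

/-- Irrationality may be checked in a single chart. -/
theorem isIrrationalAt_of_chart (B : AffineToriBundle n d π)
    {e : Bundle.Trivialization (Torus d) π} (he : e ∈ B.atlas) {v : M → (Fin d → ℝ)}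
    (hv : IsCompatibleOnWith e g v) {x : M} (hx : x ∈ e.baseSet)
    (h : ∀ ξ : Fin d → ℤ, ξ ≠ 0 → ∑ i, (ξ i : ℝ) * v x i ≠ 0) : B.IsIrrationalAt g x := by
  intro e' he' hx' v' hv' ξ hξ h0
  obtain ⟨A, hA⟩ := B.exists_velocity_eq he he' hv hv'
  -- An integer relation `ξ` for `v' = A v` is the relation `ξ A` for `v`, and `ξ A` is nonzero
  -- because `A` is invertible over the integers.
  refine h (Matrix.vecMul ξ (A : Matrix (Fin d) (Fin d) ℤ)) (fun h1 => hξ ?_) ?_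
  · have h2 := congrArg (fun η => Matrix.vecMul η ((A⁻¹ : Matrix.GeneralLinearGroup (Fin d) ℤ) :
      Matrix (Fin d) (Fin d) ℤ)) h1
    simpa [Matrix.vecMul_vecMul, ← Units.val_mul] using h2
  · rw [hA x ⟨hx, hx'⟩] at h0
    rw [← h0]
    simp only [Matrix.vecMul, dotProduct, Int.cast_sum, Int.cast_mul, Finset.sum_mul,
      Finset.mul_sum]
    rw [Finset.sum_comm]
    exact Finset.sum_congr rfl fun i _ => Finset.sum_congr rfl fun j _ => by ring

/-- Compatibility only sees the velocity on the base set, where it is continuous, so extension by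
zero makes it globally measurable at no cost. -/
theorem IsCompatibleFlow.exists_measurable_velocity [MeasurableSpace M] [BorelSpace M]
    (hg : B.IsCompatibleFlow g) {e : Bundle.Trivialization (Torus d) π} (he : e ∈ B.atlas) :
    ∃ v : M → (Fin d → ℝ), Measurable v ∧ IsCompatibleOnWith e g v := by
  classical
  obtain ⟨v, hv⟩ := hg e he
  refine ⟨e.baseSet.piecewise v 0,
    hv.1.measurable_piecewise continuousOn_const e.open_baseSet.measurableSet,
    hv.congr fun x hx => Set.piecewise_eq_of_mem _ _ _ hx⟩

end AffineToriBundle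

/-! ### Functions supported in a chart -/

/-- The truncated distance to the complement. Vanishing off `U` allows chart functions to be
extended by zero; strict positivity on `U` lets a zero integral of `φ` detect null subsets of `U`.
-/
theorem IsOpen.exists_continuous_pos_iff {X : Type*} [TopologicalSpace X]
    [TopologicalSpace.PseudoMetrizableSpace X] {U : Set X} (hU : IsOpen U) :
    ∃ φ : X → ℝ, Continuous φ ∧ (∀ x, 0 ≤ φ x) ∧ (∀ x, φ x ≤ 1) ∧ ∀ x, 0 < φ x ↔ x ∈ U := by
  let := TopologicalSpace.pseudoMetrizableSpacePseudoMetric X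
  -- The truncation at `1` also covers `U = X`, where the distance to the empty complement is
  -- infinite.
  have hle : ∀ x, min 1 (Metric.infEDist x Uᶜ) ≤ 1 := fun x => min_le_left _ _
  have hne : ∀ x, min 1 (Metric.infEDist x Uᶜ) ≠ ⊤ := fun x =>
    ((hle x).trans_lt ENNReal.one_lt_top).ne
  refine ⟨fun x => (min 1 (Metric.infEDist x Uᶜ)).toReal, ?_, fun _ => ENNReal.toReal_nonneg,
    fun x => ?_, fun x => ?_⟩
  · exact ENNReal.continuousOn_toReal.comp_continuous
      (continuous_const.min Metric.continuous_infEDist) hne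
  · exact ENNReal.toReal_le_of_le_ofReal zero_le_one (by simp)
  · rw [ENNReal.toReal_pos_iff, lt_min_iff, pos_iff_ne_zero (a := Metric.infEDist x Uᶜ), Ne,
      ← Metric.mem_closure_iff_infEDist_zero, hU.isClosed_compl.closure_eq, notMem_compl_iff]
    simp [(hne x).lt_top]

section ChartCharacter

variable {d : ℕ} {M Ω : Type*} [TopologicalSpace M] [TopologicalSpace Ω] {π : Ω → M}

/-- Over a point outside the base set the character may be discontinuous, but it is unimodular, so
the product is dominated by `φ ∘ π`, which tends to zero there. -/
theorem continuous_mul_mFourier_chartCoord (hπ : Continuous π)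
    (e : Bundle.Trivialization (Torus d) π) {φ : M → ℝ} (hφ : Continuous φ)
    (h0 : ∀ x ∉ e.baseSet, φ x = 0) (ξ : Fin d → ℤ) :
    Continuous fun p => (φ (π p) : ℂ) * UnitAddTorus.mFourier ξ (chartCoord e p).2 := by
  refine continuous_iff_continuousAt.2 fun p => ?_
  have hφc : ContinuousAt (fun p => (φ (π p) : ℂ)) p :=
    (Complex.continuous_ofReal.comp (hφ.comp hπ)).continuousAt
  by_cases hp : π p ∈ e.baseSet
  · refine hφc.mul ?_
    have h1 : ContinuousAt (fun p => UnitAddTorus.mFourier ξ (e p).2) p :=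
      ((UnitAddTorus.mFourier ξ).continuous.comp continuous_snd).continuousAt.comp
        (e.continuousAt (e.mem_source.2 hp))
    refine h1.congr ?_
    filter_upwards [(e.open_baseSet.preimage hπ).mem_nhds hp] with q hq
    rw [chartCoord_eq e hq]
  · have h2 : Tendsto (fun p => (φ (π p) : ℂ)) (𝓝 p) (𝓝 0) := by
      simpa [h0 _ hp] using hφc.tendsto
    rw [ContinuousAt, h0 _ hp, Complex.ofReal_zero, zero_mul]
    refine squeeze_zero_norm (fun q => ?_) (tendsto_zero_iff_norm_tendsto_zero.1 h2)
    rw [norm_mul, norm_mFourier_apply, mul_one]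

end ChartCharacter

/-! ### Irrationality from convergence -/

namespace AffineToriBundle

variable {n d : ℕ} {M Ω : Type*}
  [TopologicalSpace M] [ChartedSpace (EuclideanSpace ℝ (Fin n)) M]
  [MeasurableSpace M] [BorelSpace M]
  [TopologicalSpace Ω] [ChartedSpace (EuclideanSpace ℝ (Fin (n + d))) Ω]
  [MeasurableSpace Ω] [BorelSpace Ω]
  {π : Ω → M} {B : AffineToriBundle n d π} {g : Flow ℝ Ω}

/-- Nontrivial characters of the fibres have integral zero. -/
theorem IsCompatibleMeasure.setIntegral_mFourier_eq_zero {μ : Measure Ω} [IsFiniteMeasure μ]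
    (hμ : B.IsCompatibleMeasure μ) {e : Bundle.Trivialization (Torus d) π} (he : e ∈ B.atlas)
    {A : Set M} (hA : MeasurableSet A) (hAe : A ⊆ e.baseSet) {φ : M → ℂ} (hφ : Measurable φ)
    {ξ : Fin d → ℤ} (hξ : ξ ≠ 0) :
    ∫ p in π ⁻¹' A, φ (π p) * UnitAddTorus.mFourier ξ (chartCoord e p).2 ∂μ = 0 := by
  have hc := measurable_chartCoord B.measurable_proj e
  have hm : Measurable fun q : M × Torus d => φ q.1 * UnitAddTorus.mFourier ξ q.2 :=
    (hφ.comp measurable_fst).mul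
      ((UnitAddTorus.mFourier ξ).continuous.measurable.comp measurable_snd)
  have h := integral_map (μ := μ.restrict (π ⁻¹' A)) hc.aemeasurable hm.aestronglyMeasurable
  rw [hμ.map_chartCoord he hA hAe, integral_prod_mul, integral_mFourier_eq_zero hξ, mul_zero] at h
  exact h.symm

/-- If all measures with marginal `ν` converge to `ν ⊗ Leb`, there is no set of positive measure
on which the velocity satisfies a given integer relation. -/
theorem measure_resonance_eq_zero [T2Space M] [SecondCountableTopology M]
    [CompactSpace Ω] (hg : B.IsCompatibleFlow g)
    {ν : ProbabilityMeasure M} {νLeb : ProbabilityMeasure Ω} (hν : νLeb ∈ prescribedMarginal π ν)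
    (hc : B.IsCompatibleMeasure (νLeb : Measure Ω))
    (hlim : ∀ μ ∈ prescribedMarginal π ν,
      Tendsto (fun t : ℝ => flowPush g t μ) atTop (𝓝 νLeb))
    {e : Bundle.Trivialization (Torus d) π} (he : e ∈ B.atlas) {v : M → (Fin d → ℝ)}
    (hvm : Measurable v) (hv : IsCompatibleOnWith e g v) {ξ : Fin d → ℤ} (hξ : ξ ≠ 0) :
    (ν : Measure M) {x | x ∈ e.baseSet ∧ ∑ i, (ξ i : ℝ) * v x i = 0} = 0 := by
  have := B.compactSpace_base
  have hπ := B.measurable_proj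
  have hU := e.open_baseSet.measurableSet
  obtain ⟨φ, hφc, hφ0, hφ1, hφU⟩ := e.open_baseSet.exists_continuous_pos_iff
  have hφ0' : ∀ x ∉ e.baseSet, φ x = 0 := fun x hx =>
    le_antisymm (not_lt.1 fun h => hx ((hφU x).1 h)) (hφ0 x)
  have hνm : (νLeb : Measure Ω).map π = (ν : Measure M) := hν
  obtain ⟨x₀⟩ := (ν : Measure M).nonempty_of_neZero
  obtain ⟨p₀, -⟩ := B.surjective x₀
  set E : Set M := {x | x ∈ e.baseSet ∧ ∑ i, (ξ i : ℝ) * v x i = 0}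
  have hE : MeasurableSet E := hU.inter <| measurableSet_eq_fun
    (Finset.measurable_fun_sum _ fun i _ => measurable_const.mul ((measurable_pi_apply i).comp hvm))
    measurable_const
  have hEU : E ⊆ e.baseSet := fun x hx => hx.1
  set f : Ω → ℂ := fun p => (φ (π p) : ℂ) * UnitAddTorus.mFourier ξ (chartCoord e p).2
  have hf : Continuous f :=
    continuous_mul_mFourier_chartCoord B.contMDiff_proj.continuous e hφc hφ0' ξ
  set F : BoundedContinuousFunction Ω ℂ := BoundedContinuousFunction.mkOfCompact ⟨f, hf⟩
  have hσ : Measurable fun x : M => chartInv e p₀ (x, (0 : Torus d)) :=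
    (measurable_chartInv e p₀).comp (measurable_id.prodMk measurable_const)
  -- the measure which is the zero section over `E` and Lebesgue elsewhere
  set μ₁ : Measure Ω := (νLeb : Measure Ω).restrict (π ⁻¹' Eᶜ)
  set μ₂ : Measure Ω := ((ν : Measure M).restrict E).map fun x => chartInv e p₀ (x, 0)
  have hμπ : (μ₁ + μ₂).map π = (ν : Measure M) := by
    rw [Measure.map_add _ _ hπ, ← Measure.restrict_map hπ hE.compl, hνm, Measure.map_map hπ hσ]
    have : ((ν : Measure M).restrict E).map (π ∘ fun x => chartInv e p₀ (x, (0 : Torus d))) =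
        ((ν : Measure M).restrict E).map id := Measure.map_congr <|
      (ae_restrict_iff' hE).2 <| Eventually.of_forall fun x hx => proj_chartInv e p₀ (hEU hx) 0
    rw [this, Measure.map_id, add_comm, Measure.restrict_add_restrict_compl hE]
  have hμp : IsProbabilityMeasure (μ₁ + μ₂) := by
    have : IsProbabilityMeasure ((μ₁ + μ₂).map π) := hμπ ▸ inferInstance
    exact Measure.isProbabilityMeasure_of_map π
  have hμ₂ : IsFiniteMeasure μ₂ := by infer_instance
  have hgt : ∀ t : ℝ, Continuous (g t) := fun t => g.continuous continuous_const continuous_id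
  have key : ∀ t : ℝ, ∫ p, F p ∂(flowPush g t ⟨μ₁ + μ₂, hμp⟩ : Measure Ω) =
      ∫ x in E, (φ x : ℂ) ∂(ν : Measure M) := by
    intro t
    have h0 : ∫ p, F p ∂(flowPush g t ⟨μ₁ + μ₂, hμp⟩ : Measure Ω) =
        ∫ p, f (g t p) ∂(μ₁ + μ₂) :=
      integral_map (hgt t).measurable.aemeasurable hf.measurable.aestronglyMeasurable
    have hint : ∀ m : Measure Ω, IsFiniteMeasure m → Integrable (fun p => f (g t p)) m :=
      fun m _ => (BoundedContinuousFunction.mkOfCompact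
        (⟨fun p => f (g t p), hf.comp (hgt t)⟩ : C(Ω, ℂ))).integrable m
    rw [h0, integral_add_measure (hint _ inferInstance) (hint _ inferInstance)]
    have hchar : ∀ p, π p ∈ e.baseSet → f (g t p) =
        ((φ (π p) : ℂ) * UnitAddTorus.mFourier ξ (torusProj (t • v (π p)))) *
          UnitAddTorus.mFourier ξ (chartCoord e p).2 := by
      intro p hp
      simp only [f, hv.chartCoord_apply t hp, hg.proj_apply t p, mFourier_apply_add]
      ring
    -- Away from `E` the fibres carry Haar measure, and the flow only multiplies the character by a
    -- function of the base point.
    have h1 : ∫ p, f (g t p) ∂μ₁ = 0 := by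
      have hs : ∀ p ∈ π ⁻¹' Eᶜ \ π ⁻¹' (Eᶜ ∩ e.baseSet), f (g t p) = 0 := by
        intro p hp
        have : π p ∉ e.baseSet := fun h => hp.2 ⟨hp.1, h⟩
        simp [f, hg.proj_apply t p, hφ0' _ this]
      change ∫ p in π ⁻¹' Eᶜ, f (g t p) ∂(νLeb : Measure Ω) = 0
      rw [setIntegral_eq_of_subset_of_forall_sdiff_eq_zero (hπ hE.compl)
        (preimage_mono inter_subset_left) hs, setIntegral_congr_fun (hπ (hE.compl.inter hU))
          fun p hp => hchar p hp.2]
      refine hc.setIntegral_mFourier_eq_zero he (hE.compl.inter hU) inter_subset_right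
        (φ := fun x => (φ x : ℂ) * UnitAddTorus.mFourier ξ (torusProj (t • v x))) ?_ hξ
      exact (Complex.measurable_ofReal.comp hφc.measurable).mul <|
        ((UnitAddTorus.mFourier ξ).continuous.comp continuous_torusProj).measurable.comp
          (hvm.const_smul t)
    -- Over `E` the phase `t⟨ξ, v⟩` is zero for all `t`, and the character equals `1` on the zero
    -- section.
    have h2 : ∫ p, f (g t p) ∂μ₂ = ∫ x in E, (φ x : ℂ) ∂(ν : Measure M) := by
      refine (integral_map hσ.aemeasurable
        (hf.comp (hgt t)).measurable.aestronglyMeasurable).trans ?_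
      refine setIntegral_congr_fun hE fun x hx => ?_
      have hp := proj_chartInv e p₀ (hEU hx) (0 : Torus d)
      have hsum : ∑ i, (ξ i : ℝ) * (t • v x) i = 0 := by
        simp only [Pi.smul_apply, smul_eq_mul, mul_left_comm _ t, ← Finset.mul_sum, hx.2, mul_zero]
      have hz : UnitAddTorus.mFourier ξ (0 : Torus d) = 1 := by
        simp [UnitAddTorus.mFourier]
      change f (g t (chartInv e p₀ (x, 0))) = (φ x : ℂ)
      rw [hchar _ (by rw [hp]; exact hEU hx), hp, chartCoord_chartInv e p₀ (hEU hx),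
        mFourier_torusProj, hsum, hz]
      simp
    rw [h1, h2, zero_add]
  have hl := (ProbabilityMeasure.tendsto_iff_forall_integral_rclike_tendsto ℂ).1
    (hlim ⟨μ₁ + μ₂, hμp⟩ hμπ) F
  simp only [key] at hl
  have hl' := tendsto_nhds_unique hl tendsto_const_nhds
  have hlz : ∫ p, F p ∂(νLeb : Measure Ω) = 0 := by
    have hs : ∀ p ∉ π ⁻¹' e.baseSet, f p = 0 := fun p hp => by simp [f, hφ0' _ hp]
    change ∫ p, f p ∂(νLeb : Measure Ω) = 0
    rw [← setIntegral_eq_integral_of_forall_compl_eq_zero hs]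
    exact hc.setIntegral_mFourier_eq_zero he hU subset_rfl
      (Complex.measurable_ofReal.comp hφc.measurable) hξ
  rw [hlz, integral_complex_ofReal] at hl'
  have hr : ∫ x in E, φ x ∂(ν : Measure M) = 0 := by exact_mod_cast hl'.symm
  have hφi : Integrable φ ((ν : Measure M).restrict E) :=
    Integrable.of_bound hφc.measurable.aestronglyMeasurable 1
      (Eventually.of_forall fun x => by rw [Real.norm_of_nonneg (hφ0 x)]; exact hφ1 x)
  have hae := (integral_eq_zero_iff_of_nonneg hφ0 hφi).1 hr
  rw [Filter.EventuallyEq, ae_restrict_iff' hE] at hae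
  refine measure_mono_null (fun x hx => ?_) (ae_iff.1 hae)
  exact fun h => ((hφU x).2 hx.1).ne' (h hx)

theorem ae_isIrrationalAt [T2Space M] [SecondCountableTopology M]
    [CompactSpace Ω] (hg : B.IsCompatibleFlow g)
    {ν : ProbabilityMeasure M} {νLeb : ProbabilityMeasure Ω} (hν : νLeb ∈ prescribedMarginal π ν)
    (hc : B.IsCompatibleMeasure (νLeb : Measure Ω))
    (hlim : ∀ μ ∈ prescribedMarginal π ν,
      Tendsto (fun t : ℝ => flowPush g t μ) atTop (𝓝 νLeb)) :
    ∀ᵐ x ∂(ν : Measure M), B.IsIrrationalAt g x := by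
  have := B.compactSpace_base
  obtain ⟨N, e, D, he, -, hDe, -, hDu⟩ := B.exists_finite_partition
  choose v hvm hv using fun i => hg.exists_measurable_velocity (he i)
  have h : ∀ᵐ x ∂(ν : Measure M), ∀ (i : Fin N) (ξ : Fin d → ℤ), ξ ≠ 0 →
      ¬ (x ∈ (e i).baseSet ∧ ∑ j, (ξ j : ℝ) * v i x j = 0) := by
    refine ae_all_iff.2 fun i => ae_all_iff.2 fun ξ => ?_
    by_cases hξ : ξ = 0
    · exact Eventually.of_forall fun x h => absurd hξ h
    · filter_upwards [measure_eq_zero_iff_ae_notMem.1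
        (measure_resonance_eq_zero hg hν hc hlim (he i) (hvm i) (hv i) hξ)] with x hx _
      exact hx
  filter_upwards [h] with x hx
  obtain ⟨i, hi⟩ := mem_iUnion.1 (hDu ▸ mem_univ x : x ∈ ⋃ i, D i)
  exact B.isIrrationalAt_of_chart (he i) (hv i) (hDe i hi)
    fun ξ hξ h0 => hx i ξ hξ ⟨hDe i hi, h0⟩

end AffineToriBundle

/-! ### Unique ergodicity from convergence to a fixed point -/

/-- For an invariant `m`, `∫ F ∘ G t dm` does not depend on `t` and tends to `F x₀`. Metrizability
is what makes bounded continuous functions determine a Borel measure. -/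
theorem isUniquelyErgodic_of_tendsto {X : Type*} [TopologicalSpace X]
    [TopologicalSpace.MetrizableSpace X] {G : ℝ → X → X} (hG : ∀ t, Continuous (G t)) {x₀ : X}
    (hfix : ∀ t, G t x₀ = x₀) (hlim : ∀ x, Tendsto (fun t => G t x) atTop (𝓝 x₀)) :
    IsUniquelyErgodic G := by
  let _ : MeasurableSpace X := borel X
  have : BorelSpace X := ⟨rfl⟩
  refine ⟨Measure.dirac x₀, ⟨inferInstance, fun t => ⟨(hG t).measurable, ?_⟩⟩, ?_⟩
  · rw [Measure.map_dirac' (hG t).measurable, hfix]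
  rintro m ⟨hm, hmG⟩
  refine ext_of_forall_integral_eq_of_IsFiniteMeasure fun F => ?_
  have h1 : ∀ t, ∫ x, F (G t x) ∂m = ∫ x, F x ∂m := fun t => by
    conv_rhs => rw [← (hmG t).map_eq]
    exact (integral_map (hG t).measurable.aemeasurable
      F.continuous.measurable.aestronglyMeasurable).symm
  have h2 : Tendsto (fun t => ∫ x, F (G t x) ∂m) atTop (𝓝 (∫ _, F x₀ ∂m)) := by
    refine tendsto_integral_filter_of_dominated_convergence (fun _ => ‖F‖)
      (Eventually.of_forall fun t =>
        (F.continuous.comp (hG t)).measurable.aestronglyMeasurable)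
      (Eventually.of_forall fun t => Eventually.of_forall fun x => F.norm_coe_le_norm _)
      (integrable_const _) (Eventually.of_forall fun x => ?_)
    exact (F.continuous.tendsto x₀).comp (hlim x)
  simp only [h1] at h2
  rw [tendsto_nhds_unique tendsto_const_nhds h2, integral_dirac]
  simp

/-! ### Weak convergence in a Hilbert space -/

theorem tendsto_toWeakSpace_iff_inner {E α : Type*} [NormedAddCommGroup E] [InnerProductSpace ℂ E]
    [CompleteSpace E] {l : Filter α} {f : α → E} {x : E} :
    Tendsto (fun a => toWeakSpace ℂ E (f a)) l (𝓝 (toWeakSpace ℂ E x)) ↔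
      ∀ y : E, Tendsto (fun a => inner ℂ y (f a)) l (𝓝 (inner ℂ y x)) := by
  have hinj : Function.Injective (topDualPairing ℂ E).flip := by
    intro a b hab
    rw [← sub_eq_zero, ← inner_self_eq_zero (𝕜 := ℂ)]
    have h := LinearMap.congr_fun hab (innerSL ℂ (a - b))
    simp only [LinearMap.flip_apply, topDualPairing_apply, innerSL_apply_apply] at h
    rw [inner_sub_right, h, sub_self]
  refine (WeakBilin.tendsto_iff_forall_eval_tendsto (topDualPairing ℂ E).flip hinj).trans ?_
  constructor
  · intro h y
    exact h (innerSL ℂ y)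
  · intro h φ
    obtain ⟨y, rfl⟩ := (InnerProductSpace.toDual ℂ E).surjective φ
    exact h y

/-- The functionals `f ↦ ⟨h, U a f⟩` are `‖h‖`-Lipschitz uniformly in `a`, hence equicontinuous;
convergence then passes to limits in `f` and may be tested on a dense set. -/
theorem isClosed_setOf_tendsto_inner_right {E α : Type*} [NormedAddCommGroup E]
    [InnerProductSpace ℂ E] {l : Filter α} (U : α → E →ₗᵢ[ℂ] E) (P : E →L[ℂ] E) (h : E) :
    IsClosed {f : E | Tendsto (fun a => inner ℂ h (U a f)) l (𝓝 (inner ℂ h (P f)))} := by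
  refine Equicontinuous.isClosed_setOfPred_tendsto (F := fun a f => inner ℂ h (U a f))
    (UniformEquicontinuous.equicontinuous ?_) (continuous_const.inner P.continuous)
  refine LipschitzWith.uniformEquicontinuous _ ‖h‖₊ fun a => LipschitzWith.of_dist_le_mul ?_
  intro x y
  rw [dist_eq_norm, dist_eq_norm, ← inner_sub_right, ← map_sub]
  exact (norm_inner_le_norm _ _).trans_eq (by rw [(U a).norm_map, coe_nnnorm])

theorem isClosed_setOf_tendsto_inner_left {E α : Type*} [NormedAddCommGroup E]
    [InnerProductSpace ℂ E] {l : Filter α} (U : α → E →ₗᵢ[ℂ] E) (P : E →L[ℂ] E) (f : E) :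
    IsClosed {h : E | Tendsto (fun a => inner ℂ h (U a f)) l (𝓝 (inner ℂ h (P f)))} := by
  refine Equicontinuous.isClosed_setOfPred_tendsto (F := fun a h => inner ℂ h (U a f))
    (UniformEquicontinuous.equicontinuous ?_) (continuous_id.inner continuous_const)
  refine LipschitzWith.uniformEquicontinuous _ ‖f‖₊ fun a => LipschitzWith.of_dist_le_mul ?_
  intro x y
  rw [dist_eq_norm, dist_eq_norm, ← inner_sub_left]
  exact (norm_inner_le_norm _ _).trans_eq (by rw [(U a).norm_map, mul_comm, coe_nnnorm])

/-! ### Keplerian shear from convergence -/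

section Shear

/-- Functions which are measurable with respect to the invariant sets are invariant. -/
theorem comp_eq_of_measurable_invariantSigmaAlgebra {Ω β : Type*} [MeasurableSpace Ω]
    [MeasurableSpace β] [MeasurableSingletonClass β] {g : ℝ → Ω → Ω} {k : Ω → β}
    (hk : Measurable[invariantSigmaAlgebra g] k) (t : ℝ) (p : Ω) : k (g t p) = k p := by
  have h := (MeasurableSpace.measurable_invariants_dom.1 (hk.mono (iInf_le _ t) le_rfl)).2
    {k p} (measurableSet_singleton _)
  exact (Set.ext_iff.1 h p).2 rfl

/-- Preimages of sets in the base are invariant. -/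
theorem measurableSet_preimage_invariantSigmaAlgebra {M Ω : Type*} [MeasurableSpace M]
    [MeasurableSpace Ω] {π : Ω → M} {g : ℝ → Ω → Ω} (hπ : Measurable π)
    (hπg : ∀ t p, π (g t p) = π p) {A : Set M} (hA : MeasurableSet A) :
    MeasurableSet[invariantSigmaAlgebra g] (π ⁻¹' A) := by
  refine MeasurableSpace.measurableSet_iInf.2 fun t => ⟨hπ hA, ?_⟩
  ext p
  simp [hπg t p]

variable {M Ω : Type*} [MeasurableSpace M] [TopologicalSpace Ω] [MeasurableSpace Ω]
  {π : Ω → M} {g : Flow ℝ Ω} {ν : ProbabilityMeasure M} {μ : ProbabilityMeasure Ω}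

/-- The density `1 + 1_S - E(1_S | 𝓘)` does not change the marginal. -/
theorem exists_marginal_density (hπ : Measurable π) (hπg : ∀ t p, π (g t p) = π p)
    (hμ : μ ∈ prescribedMarginal π ν) {S : Set Ω} (hS : MeasurableSet S) :
    ∃ m ∈ prescribedMarginal π ν, ∀ f : Ω → ℂ, ∫ p, f p ∂(m : Measure Ω) =
      ∫ p, ((1 + S.indicator 1 p -
        ((μ : Measure Ω)[S.indicator (1 : Ω → ℝ) | invariantSigmaAlgebra fun t => g t]) p : ℝ) : ℂ)
          * f p ∂(μ : Measure Ω) := by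
  have hm := invariantSigmaAlgebra_le fun t => g t
  set k : Ω → ℝ := (μ : Measure Ω)[S.indicator (1 : Ω → ℝ) | invariantSigmaAlgebra fun t => g t]
  have hSi : Integrable (S.indicator (1 : Ω → ℝ)) (μ : Measure Ω) :=
    (integrable_const (1 : ℝ)).indicator hS
  have hki : Integrable k (μ : Measure Ω) := integrable_condExp
  have hkm : Measurable k := (stronglyMeasurable_condExp.measurable).mono hm le_rfl
  -- This bound makes the density nonnegative.
  have hk1 : ∀ᵐ p ∂(μ : Measure Ω), k p ≤ 1 := by
    have h := condExp_mono (m := invariantSigmaAlgebra fun t => g t) hSi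
      (integrable_const (1 : ℝ)) (Eventually.of_forall fun p =>
        Set.indicator_le_self' (f := (1 : Ω → ℝ)) (fun _ _ => zero_le_one) p)
    rw [condExp_const hm] at h
    exact h
  set ρ : Ω → ℝ := fun p => 1 + S.indicator 1 p - k p
  have hρm : Measurable ρ := ((measurable_const).add (measurable_one.indicator hS)).sub hkm
  have hρi : Integrable ρ (μ : Measure Ω) := ((integrable_const _).add hSi).sub hki
  have hρ0 : ∀ᵐ p ∂(μ : Measure Ω), 0 ≤ ρ p := by
    filter_upwards [hk1] with p hp
    have : (0 : ℝ) ≤ S.indicator 1 p := Set.indicator_nonneg (fun _ _ => zero_le_one) p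
    simp only [ρ]
    linarith
  set m : Measure Ω := (μ : Measure Ω).withDensity fun p => ENNReal.ofReal (ρ p)
  have hmπ : m.map π = (ν : Measure M) := by
    rw [← (hμ : (μ : Measure Ω).map π = (ν : Measure M))]
    ext A hA
    rw [Measure.map_apply hπ hA, Measure.map_apply hπ hA, withDensity_apply _ (hπ hA),
      ← ofReal_integral_eq_lintegral_ofReal hρi.integrableOn (ae_restrict_of_ae hρ0)]
    -- The set `π ⁻¹' A` is invariant, so `1_S` and its conditional expectation have the same
    -- integral over it and cancel.
    have : ∫ p in π ⁻¹' A, ρ p ∂(μ : Measure Ω) = (μ : Measure Ω).real (π ⁻¹' A) := by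
      have h1 : Integrable (fun p => (1 : ℝ) + S.indicator 1 p) ((μ : Measure Ω).restrict (π ⁻¹' A)) :=
        ((integrable_const (1 : ℝ)).add hSi).integrableOn
      rw [integral_sub h1 hki.integrableOn, integral_add (integrable_const _) hSi.integrableOn,
        setIntegral_condExp hm hSi (measurableSet_preimage_invariantSigmaAlgebra hπ hπg hA)]
      simp
    rw [this, ofReal_measureReal]
  have hmp : IsProbabilityMeasure m := by
    have : IsProbabilityMeasure (m.map π) := hmπ ▸ inferInstance
    exact Measure.isProbabilityMeasure_of_map π
  refine ⟨⟨m, hmp⟩, hmπ, fun f => ?_⟩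
  change ∫ p, f p ∂m = _
  rw [integral_withDensity_eq_integral_toReal_smul hρm.ennreal_ofReal
    (Eventually.of_forall fun _ => ENNReal.ofReal_lt_top)]
  refine integral_congr_ae ?_
  filter_upwards [hρ0] with p hp
  rw [ENNReal.toReal_ofReal hp, Complex.real_smul]

variable [BorelSpace Ω]

theorem continuous_flowPush (t : ℝ) : Continuous (flowPush g t) :=
  ProbabilityMeasure.continuous_map (g.continuous continuous_const continuous_id)

theorem flowPush_add (s t : ℝ) (m : ProbabilityMeasure Ω) :
    flowPush g (s + t) m = flowPush g s (flowPush g t m) := by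
  have hg : ∀ t : ℝ, Measurable (g t) := fun t =>
    (g.continuous continuous_const continuous_id).measurable
  refine Subtype.ext ?_
  change (m : Measure Ω).map (g (s + t)) = ((m : Measure Ω).map (g t)).map (g s)
  rw [Measure.map_map (hg s) (hg t)]
  congr 1
  ext p
  exact g.map_add s t p

/-- A limit of an orbit is a fixed point, by continuity of the action and the semigroup law. This
gives the invariance of `ν ⊗ Leb` without a computation in charts. -/
theorem flowPush_eq_of_tendsto [T2Space (ProbabilityMeasure Ω)] {m : ProbabilityMeasure Ω}
    (h : Tendsto (fun t => flowPush g t m) atTop (𝓝 μ)) (s : ℝ) : flowPush g s μ = μ := by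
  refine tendsto_nhds_unique (((continuous_flowPush s).tendsto μ).comp h) ?_
  have h2 : Tendsto (fun t => flowPush g (s + t) m) atTop (𝓝 μ) :=
    h.comp (tendsto_atTop_add_const_left atTop s tendsto_id)
  exact h2.congr fun t => flowPush_add s t m

/-- Correlations of a continuous function with a set converge. -/
theorem tendsto_setIntegral_comp_flow [CompactSpace Ω] (hπ : Measurable π)
    (hπg : ∀ t p, π (g t p) = π p) (hμ : μ ∈ prescribedMarginal π ν)
    (hlim : ∀ m ∈ prescribedMarginal π ν, Tendsto (fun t : ℝ => flowPush g t m) atTop (𝓝 μ))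
    (hmp : ∀ t, MeasurePreserving (g t) (μ : Measure Ω) μ) {S : Set Ω} (hS : MeasurableSet S)
    (f : C(Ω, ℂ)) :
    Tendsto (fun t : ℝ => ∫ p in S, f (g t p) ∂(μ : Measure Ω)) atTop
      (𝓝 (∫ p, (((μ : Measure Ω)[S.indicator (1 : Ω → ℝ) |
        invariantSigmaAlgebra fun t => g t]) p : ℂ) * f p ∂(μ : Measure Ω))) := by
  have hm := invariantSigmaAlgebra_le fun t => g t
  obtain ⟨m, hmν, hmi⟩ := exists_marginal_density hπ hπg hμ hS
  set k : Ω → ℝ := (μ : Measure Ω)[S.indicator (1 : Ω → ℝ) | invariantSigmaAlgebra fun t => g t]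
  have hkI : Measurable[invariantSigmaAlgebra fun t => g t] k :=
    stronglyMeasurable_condExp.measurable
  have hki : Integrable (fun p => (k p : ℂ)) (μ : Measure Ω) :=
    (integrable_condExp (μ := (μ : Measure Ω))).ofReal
  have hgt : ∀ t : ℝ, Continuous (g t) := fun t => g.continuous continuous_const continuous_id
  have hf : ∀ t : ℝ, Integrable (fun p => f (g t p)) (μ : Measure Ω) := fun t =>
    (BoundedContinuousFunction.mkOfCompact (f.comp ⟨g t, hgt t⟩)).integrable _
  have hkf : ∀ t : ℝ, Integrable (fun p => (k p : ℂ) * f (g t p)) (μ : Measure Ω) := fun t =>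
    hki.mul_bdd (c := ‖f‖) (f.continuous.comp (hgt t)).measurable.aestronglyMeasurable
      (Eventually.of_forall fun p => f.norm_coe_le_norm _)
  -- Of the three terms of the density only the one in `1_S` depends on time: `μ` is preserved, and
  -- so is `k` along orbits.
  have key : ∀ t : ℝ, ∫ p, f p ∂(flowPush g t m : Measure Ω) = ∫ p, f p ∂(μ : Measure Ω) +
      ∫ p in S, f (g t p) ∂(μ : Measure Ω) - ∫ p, (k p : ℂ) * f p ∂(μ : Measure Ω) := by
    intro t
    have h1 : ∫ p, f p ∂(flowPush g t m : Measure Ω) = ∫ p, f (g t p) ∂(m : Measure Ω) :=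
      integral_map (hgt t).measurable.aemeasurable f.continuous.measurable.aestronglyMeasurable
    have h2 : ∀ F : Ω → ℂ, Measurable F →
        ∫ p, F (g t p) ∂(μ : Measure Ω) = ∫ p, F p ∂(μ : Measure Ω) := fun F hF => by
      conv_rhs => rw [← (hmp t).map_eq]
      exact (integral_map (hgt t).measurable.aemeasurable hF.aestronglyMeasurable).symm
    have h3 : ∫ p, (k p : ℂ) * f (g t p) ∂(μ : Measure Ω) =
        ∫ p, (k p : ℂ) * f p ∂(μ : Measure Ω) := by
      rw [← h2 (fun p => (k p : ℂ) * f p)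
        ((Complex.measurable_ofReal.comp (hkI.mono hm le_rfl)).mul f.continuous.measurable)]
      exact integral_congr_ae (Eventually.of_forall fun p => by
        simp only [comp_eq_of_measurable_invariantSigmaAlgebra hkI t p])
    have h4 : ∀ p, ((1 + S.indicator 1 p - k p : ℝ) : ℂ) * f (g t p) =
        f (g t p) + S.indicator (fun p => f (g t p)) p - (k p : ℂ) * f (g t p) := by
      intro p
      by_cases hp : p ∈ S <;> simp [hp] <;> ring
    have h5 : Integrable (fun p => f (g t p) + S.indicator (fun p => f (g t p)) p)
        (μ : Measure Ω) := (hf t).add ((hf t).indicator hS)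
    rw [h1, hmi, integral_congr_ae (Eventually.of_forall h4), integral_sub h5 (hkf t),
      integral_add (hf t) ((hf t).indicator hS), integral_indicator hS, h3,
      h2 f f.continuous.measurable]
  have hl := (ProbabilityMeasure.tendsto_iff_forall_integral_rclike_tendsto ℂ).1 (hlim m hmν)
    (BoundedContinuousFunction.mkOfCompact f)
  simp only [BoundedContinuousFunction.mkOfCompact_apply, key] at hl
  have h5 := (hl.sub_const (∫ p, f p ∂(μ : Measure Ω))).add_const
    (∫ p, (k p : ℂ) * f p ∂(μ : Measure Ω))
  rw [sub_self, zero_add] at h5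
  exact h5.congr fun t => by ring

theorem keplerianShear_of_tendsto [CompactSpace Ω] [T2Space Ω] [SecondCountableTopology Ω]
    (hπ : Measurable π) (hπg : ∀ t p, π (g t p) = π p) (hμ : μ ∈ prescribedMarginal π ν)
    (hlim : ∀ m ∈ prescribedMarginal π ν, Tendsto (fun t : ℝ => flowPush g t m) atTop (𝓝 μ)) :
    KeplerianShear (μ : Measure Ω) (fun t => g t) := by
  have hm := invariantSigmaAlgebra_le fun t => g t
  have hgt : ∀ t : ℝ, Continuous (g t) := fun t => g.continuous continuous_const continuous_id
  have hmp : ∀ t, MeasurePreserving (g t) (μ : Measure Ω) μ := fun t =>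
    ⟨(hgt t).measurable, congrArg Subtype.val (flowPush_eq_of_tendsto (hlim μ hμ) t)⟩
  refine ⟨hmp, fun f => tendsto_toWeakSpace_iff_inner.2 fun h => ?_⟩
  let U : ℝ → Lp ℂ 2 (μ : Measure Ω) →ₗᵢ[ℂ] Lp ℂ 2 (μ : Measure Ω) := fun t =>
    Lp.compMeasurePreservingₗᵢ ℂ (g t) (hmp t)
  let P : Lp ℂ 2 (μ : Measure Ω) →L[ℂ] Lp ℂ 2 (μ : Measure Ω) :=
    (lpMeas ℂ ℂ (invariantSigmaAlgebra fun t => g t) 2 (μ : Measure Ω)).subtypeL.comp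
      (condExpL2 ℂ ℂ hm)
  change Tendsto (fun t => inner ℂ h (U t f)) atTop (𝓝 (inner ℂ h (P f)))
  -- By equicontinuity it is enough to take `f` continuous and `h` a multiple of an indicator.
  have hdense := ContinuousMap.toLp_denseRange ℂ (μ : Measure Ω) ℂ (p := 2) (by simp)
  refine hdense.induction_on (p := fun f => Tendsto (fun t => inner ℂ h (U t f)) atTop
    (𝓝 (inner ℂ h (P f)))) f (isClosed_setOf_tendsto_inner_right U P h) fun F => ?_
  set f₀ := ContinuousMap.toLp (E := ℂ) 2 (μ : Measure Ω) ℂ F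
  refine Lp.induction (by simp) (fun h => Tendsto (fun t => inner ℂ h (U t f₀)) atTop
    (𝓝 (inner ℂ h (P f₀)))) ?_ ?_ (isClosed_setOf_tendsto_inner_left U P f₀) h
  · intro c S hS hμS
    have hone : ∀ x : Lp ℂ 2 (μ : Measure Ω),
        inner ℂ (Lp.simpleFunc.indicatorConst 2 hS hμS.ne c : Lp ℂ 2 (μ : Measure Ω)) x =
          inner ℂ c (inner ℂ (indicatorConstLp 2 hS hμS.ne (1 : ℂ)) x) := fun x => by
      rw [Lp.simpleFunc.coe_indicatorConst, L2.inner_indicatorConstLp_one,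
        L2.inner_indicatorConstLp_eq_inner_setIntegral]
    simp only [hone]
    refine ((continuous_const.inner continuous_id).tendsto _).comp ?_
    have hUt : ∀ t, inner ℂ (indicatorConstLp 2 hS hμS.ne (1 : ℂ)) (U t f₀) =
        ∫ p in S, F (g t p) ∂(μ : Measure Ω) := fun t => by
      rw [L2.inner_indicatorConstLp_one]
      refine setIntegral_congr_ae hS ?_
      filter_upwards [Lp.coeFn_compMeasurePreserving f₀ (hmp t),
        (hmp t).quasiMeasurePreserving.ae (ContinuousMap.coeFn_toLp (μ : Measure Ω) F (𝕜 := ℂ)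
          (p := 2))] with p h1 h2 _
      exact h1.trans h2
    have hP : inner ℂ (indicatorConstLp 2 hS hμS.ne (1 : ℂ)) (P f₀) =
        ∫ p, (((μ : Measure Ω)[S.indicator (1 : Ω → ℝ) |
          invariantSigmaAlgebra fun t => g t]) p : ℂ) * F p ∂(μ : Measure Ω) := by
      change inner ℂ (indicatorConstLp 2 hS hμS.ne (1 : ℂ)) ((condExpL2 ℂ ℂ hm f₀ :
        lpMeas ℂ ℂ (invariantSigmaAlgebra fun t => g t) 2 (μ : Measure Ω)) : Lp ℂ 2 (μ : Measure Ω)) = _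
      -- Self-adjointness moves the conditional expectation from `f₀` to the indicator of `S`.
      rw [← inner_condExpL2_left_eq_right, L2.inner_def]
      refine integral_congr_ae ?_
      have h1 := (memLp_indicator_const 2 hS (1 : ℂ) (Or.inr hμS.ne)).condExpL2_ae_eq_condExp
        (𝕜 := ℂ) hm
      have h2 := ContinuousLinearMap.comp_condExp_comm (μ := (μ : Measure Ω))
        (m := invariantSigmaAlgebra fun t => g t)
        ((integrable_const (1 : ℝ)).indicator hS) Complex.ofRealCLM
      have h3 : (Complex.ofRealCLM ∘ S.indicator fun _ => (1 : ℝ)) = S.indicator fun _ => (1 : ℂ) := by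
        ext p
        by_cases hp : p ∈ S <;> simp [hp]
      rw [h3] at h2
      filter_upwards [h1, h2, ContinuousMap.coeFn_toLp (μ : Measure Ω) F (𝕜 := ℂ)
          (p := 2)] with p hp1 hp2 hp3
      rw [RCLike.inner_apply]
      have h4 : ((condExpL2 ℂ ℂ hm (indicatorConstLp 2 hS hμS.ne (1 : ℂ)) :
        lpMeas ℂ ℂ (invariantSigmaAlgebra fun t => g t) 2 (μ : Measure Ω)) : Lp ℂ 2 (μ : Measure Ω)) p =
          (((μ : Measure Ω)[S.indicator (1 : Ω → ℝ) |
            invariantSigmaAlgebra fun t => g t]) p : ℂ) := hp1.trans hp2.symm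
      rw [h4, Complex.conj_ofReal, mul_comm, show f₀ p = F p from hp3]
    rw [hP]
    exact (tendsto_setIntegral_comp_flow hπ hπg hμ hlim hmp hS F).congr fun t => (hUt t).symm
  · intro h₁ h₂ hh₁ hh₂ _ H₁ H₂
    simp only [inner_add_left]
    exact H₁.add H₂

end Shear

/-! ### Eigenfunctions of a flow with Keplerian shear -/

open scoped ComplexConjugate in
/-- If `f` is fibrewise an eigenfunction with nonzero frequency `w`, its correlations vanish. -/
theorem KeplerianShear.tendsto_integral_eigenfunction {Ω : Type*} [MeasurableSpace Ω]
    {μ : Measure Ω} [IsFiniteMeasure μ] {g : ℝ → Ω → Ω} (hks : KeplerianShear μ g) {f : Ω → ℂ}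
    (hf : Measurable f) (hfb : ∀ p, ‖f p‖ ≤ 1) {w : Ω → ℝ} (hw : Measurable w)
    (hfg : ∀ (t : ℝ) p, f (g t p) =
      Complex.exp (2 * Real.pi * Complex.I * (t * w p : ℝ)) * f p)
    (hw0 : ∀ᵐ p ∂μ, f p ≠ 0 → w p ≠ 0) {z : Ω → ℂ} (hz : MemLp z 2 μ)
    (hz0 : ∀ p, f p = 0 → z p = 0) :
    Tendsto (fun t : ℝ => ∫ p, conj (z p) *
      (Complex.exp (2 * Real.pi * Complex.I * (t * w p : ℝ)) * f p) ∂μ) atTop (𝓝 0) := by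
  obtain ⟨hg, hlim⟩ := hks
  set q : ℝ → Ω → ℂ := fun t p => Complex.exp (2 * Real.pi * Complex.I * (t * w p : ℝ))
  have hqm : ∀ t, Measurable (q t) := fun t => Complex.measurable_exp.comp
    (measurable_const.mul (Complex.measurable_ofReal.comp (measurable_const.mul hw)))
  have hqn : ∀ t p, ‖q t p‖ = 1 := fun t p => by
    have : q t p = Complex.exp ((2 * Real.pi * (t * w p) : ℝ) * Complex.I) := by
      simp only [q]; congr 1; push_cast; ring
    rw [this, Complex.norm_exp_ofReal_mul_I]
  have hqadd : ∀ s t p, q (s + t) p = q s p * q t p := fun s t p => by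
    simp only [q, ← Complex.exp_add]; congr 1; push_cast; ring
  have hfm : MemLp f 2 μ :=
    MemLp.of_bound hf.aestronglyMeasurable 1 (Eventually.of_forall hfb)
  set f' : Lp ℂ 2 μ := hfm.toLp f
  set k : Lp ℂ 2 μ := ((condExpL2 ℂ ℂ (invariantSigmaAlgebra_le g) f' :
    lpMeas ℂ ℂ (invariantSigmaAlgebra g) 2 μ) : Lp ℂ 2 μ)
  have hweak := tendsto_toWeakSpace_iff_inner.1 (hlim f')
  have hU : ∀ t, Lp.compMeasurePreserving (g t) (hg t) f' =ᵐ[μ] fun p => q t p * f p := by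
    intro t
    filter_upwards [Lp.coeFn_compMeasurePreserving f' (hg t),
      (hg t).quasiMeasurePreserving.ae hfm.coeFn_toLp] with p h1 h2
    rw [h1]
    exact h2.trans (hfg t p)
  have hint : ∀ (z : Ω → ℂ) (hz : MemLp z 2 μ), Tendsto
      (fun t => ∫ p, conj (z p) * (q t p * f p) ∂μ) atTop (𝓝 (∫ p, conj (z p) * k p ∂μ)) := by
    intro z hz
    have h := hweak (hz.toLp z)
    rw [L2.inner_def] at h
    have h2 : ∫ p, inner ℂ (hz.toLp z p) (k p) ∂μ = ∫ p, conj (z p) * k p ∂μ := by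
      refine integral_congr_ae ?_
      filter_upwards [hz.coeFn_toLp] with p hp
      rw [hp, RCLike.inner_apply, mul_comm]
    rw [h2] at h
    refine h.congr fun t => ?_
    rw [L2.inner_def]
    refine integral_congr_ae ?_
    filter_upwards [hz.coeFn_toLp, hU t] with p hp hp2
    rw [hp, hp2, RCLike.inner_apply, mul_comm]
  have hmul : ∀ (a : Ω → ℂ) (b : Ω → ℂ), Measurable a → (∀ p, ‖a p‖ = 1) → MemLp b 2 μ →
      MemLp (fun p => a p * b p) 2 μ := fun a b ha ha1 hb =>
    hb.of_le (ha.aestronglyMeasurable.mul hb.aestronglyMeasurable)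
      (Eventually.of_forall fun p => by rw [norm_mul, ha1, one_mul])
  have hk : MemLp k 2 μ := Lp.memLp k
  -- the weak limit is invariant under multiplication by `q s`
  have hinv : ∀ s : ℝ, ∀ᵐ p ∂μ, q s p * k p = k p := by
    intro s
    -- Put `D = q_s k - k`. Testing against `conj(q_s) D` at time `t`, or against `D` at time `s +
    -- t`, produces the same integral; equating the two limits gives `‖D‖² = 0`.
    have hd : MemLp (fun p => q s p * k p - k p) 2 μ := (hmul _ _ (hqm s) (hqn s) hk).sub hk
    have hd2 : MemLp (fun p => conj (q s p) * (q s p * k p - k p)) 2 μ :=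
      hmul _ _ (Complex.continuous_conj.measurable.comp (hqm s))
        (fun p => by rw [RCLike.norm_conj, hqn]) hd
    have h1 := hint _ hd2
    have h2 : Tendsto (fun t => ∫ p, conj (q s p * k p - k p) * (q (s + t) p * f p) ∂μ) atTop
        (𝓝 (∫ p, conj (q s p * k p - k p) * k p ∂μ)) :=
      (hint _ hd).comp (tendsto_atTop_add_const_left atTop s tendsto_id)
    have h3 := tendsto_nhds_unique h1 (h2.congr fun t => integral_congr_ae <|
      Eventually.of_forall fun p => by simp only [hqadd, map_mul, Complex.conj_conj]; ring)
    have h4 : inner ℂ (hd.toLp _) (hd.toLp _) = (0 : ℂ) := by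
      rw [L2.inner_def]
      have h5 : ∫ p, inner ℂ (hd.toLp _ p) (hd.toLp _ p) ∂μ =
          ∫ p, (conj (conj (q s p) * (q s p * k p - k p)) * k p -
            conj (q s p * k p - k p) * k p) ∂μ := by
        refine integral_congr_ae ?_
        filter_upwards [hd.coeFn_toLp] with p hp
        rw [hp, RCLike.inner_apply]
        simp only [map_mul, Complex.conj_conj]
        ring
      have hconj : ∀ b : Ω → ℂ, MemLp b 2 μ → Integrable (fun p => conj (b p) * k p) μ :=
        fun b hb => (hb.star).integrable_mul hk
      rw [h5, integral_sub (hconj _ hd2) (hconj _ hd), h3, sub_self]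
    have h6 : hd.toLp _ = 0 := inner_self_eq_zero.1 h4
    filter_upwards [hd.coeFn_toLp, (Lp.eq_zero_iff_ae_eq_zero).1 h6] with p h7 h8
    rw [h7] at h8
    exact sub_eq_zero.1 h8
  -- Countably many times `1 / (m + 1)` keep the exceptional set null. If `k p ≠ 0`, then `w p / (m
  -- + 1)` is an integer for all `m`, and taking `m > |w p|` forces `w p = 0`.
  have hk0 : ∀ᵐ p ∂μ, f p ≠ 0 → k p = 0 := by
    filter_upwards [ae_all_iff.2 fun m : ℕ => hinv (1 / (m + 1)), hw0] with p hp hwp hfp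
    by_contra hkp
    obtain ⟨m, hm⟩ := exists_nat_gt |w p|
    have h1 : q (1 / (m + 1)) p = 1 := mul_right_cancel₀ hkp ((hp m).trans (one_mul _).symm)
    obtain ⟨j, hj⟩ := Complex.exp_eq_one_iff.1 h1
    rw [mul_comm (j : ℂ)] at hj
    have hj2 := mul_left_cancel₀ Complex.two_pi_I_ne_zero hj
    have hj3 : 1 / ((m : ℝ) + 1) * w p = j := by exact_mod_cast hj2
    have hm0 : (0 : ℝ) < m + 1 := by positivity
    have hj4 : w p = j * (m + 1) := by rw [← hj3]; field_simp
    have hj0 : j ≠ 0 := fun h => hwp hfp (by rw [hj4, h]; simp)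
    have hj5 : (1 : ℝ) ≤ |(j : ℝ)| := by exact_mod_cast Int.one_le_abs hj0
    rw [hj4, abs_mul, abs_of_pos hm0] at hm
    nlinarith
  have h0 : ∫ p, conj (z p) * k p ∂μ = 0 := by
    refine integral_eq_zero_of_ae ?_
    filter_upwards [hk0] with p hp
    by_cases h : f p = 0
    · simp [hz0 p h]
    · simp [hp h]
  exact h0 ▸ hint z hz

/-! ### Equidistribution along translations with varying velocity -/

section Translate

variable {d : ℕ} {X : Type*} [MeasurableSpace X] {ρ : Measure (X × Torus d)}

/-- Measurability comes from the joint continuity of evaluation on `C(𝕋^d) × 𝕋^d`; the sup norm of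
`F` dominates. -/
theorem integrable_eval_fibre {F : X → C(Torus d, ℂ)} (hF : Integrable F ρ.fst)
    {τ : X × Torus d → Torus d} (hτ : Measurable τ) :
    Integrable (fun q => F q.1 (τ q)) ρ := by
  have hF' : Integrable (fun q : X × Torus d => F q.1) ρ := hF.comp_measurable measurable_fst
  refine hF'.mono ?_ (Eventually.of_forall fun q => (F q.1).norm_coe_le_norm _)
  have h : Continuous fun a : C(Torus d, ℂ) × Torus d => a.1 a.2 := by fun_prop
  exact h.comp_aestronglyMeasurable
    (hF'.aestronglyMeasurable.prodMk hτ.aestronglyMeasurable)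

/-- The bound does not involve `τ`, so for translations it is uniform in time and supplies the
equicontinuity needed for approximation in `L¹`. -/
theorem norm_integral_eval_fibre_le {F : X → C(Torus d, ℂ)} (hF : Integrable F ρ.fst)
    (τ : X × Torus d → Torus d) :
    ‖∫ q, F q.1 (τ q) ∂ρ‖ ≤ ∫ x, ‖F x‖ ∂ρ.fst := by
  have h : ∫ x, ‖F x‖ ∂ρ.fst = ∫ q, ‖F q.1‖ ∂ρ :=
    integral_map measurable_fst.aemeasurable hF.norm.aestronglyMeasurable
  rw [h]
  exact norm_integral_le_of_norm_le (hF.norm.comp_measurable measurable_fst)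
    (Eventually.of_forall fun q => (F q.1).norm_coe_le_norm _)

theorem measurable_translate {v : X → (Fin d → ℝ)} (hv : Measurable v) (t : ℝ) :
    Measurable fun q : X × Torus d => q.2 + torusProj (t • v q.1) :=
  measurable_snd.add
    (continuous_torusProj.measurable.comp ((hv.comp measurable_fst).const_smul t))

/-- The case of a character on the fibres. -/
theorem tendsto_integral_indicator_mFourier [IsFiniteMeasure ρ] {v : X → (Fin d → ℝ)}
    (h : ∀ ξ : Fin d → ℤ, ξ ≠ 0 → ∀ ψ : X → ℂ, Measurable ψ → (∀ x, ‖ψ x‖ ≤ 1) →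
      Tendsto (fun t : ℝ => ∫ x, ψ x *
        Complex.exp (2 * Real.pi * Complex.I * (t * ∑ i, (ξ i : ℝ) * v x i : ℝ)) ∂ρ.fst)
        atTop (𝓝 0)) (hv : Measurable v)
    {S : Set X} (hS : MeasurableSet S) (ξ : Fin d → ℤ) :
    Tendsto (fun t : ℝ => ∫ q, S.indicator (fun _ => UnitAddTorus.mFourier ξ) q.1
        (q.2 + torusProj (t • v q.1)) ∂ρ) atTop
      (𝓝 (∫ q, S.indicator (fun _ => UnitAddTorus.mFourier ξ) q.1 q.2
        ∂(ρ.fst.prod volume))) := by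
  have hsplit : ∀ (x : X) (y : Torus d), S.indicator (fun _ => UnitAddTorus.mFourier ξ) x y =
      S.indicator (1 : X → ℂ) x * UnitAddTorus.mFourier ξ y := fun x y => by
    by_cases hx : x ∈ S <;> simp [hx]
  have hSm : Measurable (S.indicator (1 : X → ℂ)) := measurable_one.indicator hS
  simp only [hsplit]
  rw [integral_prod_mul]
  rcases eq_or_ne ξ 0 with rfl | hξ
  · simp only [UnitAddTorus.mFourier_zero, ContinuousMap.one_apply, mul_one]
    have h1 : ∫ q, S.indicator (1 : X → ℂ) q.1 ∂ρ = ∫ x, S.indicator (1 : X → ℂ) x ∂ρ.fst :=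
      (integral_map measurable_fst.aemeasurable hSm.aestronglyMeasurable).symm
    simp [h1]
  · rw [integral_mFourier_eq_zero hξ, mul_zero]
    -- The Fourier coefficient of the conditional measure on the fibre. After disintegration the
    -- integral oscillates with weight `1_S m`, which is bounded by `1`.
    set m : X → ℂ := fun x => ∫ y, UnitAddTorus.mFourier ξ y ∂(ρ.condKernel x)
    have hm : Measurable m := (StronglyMeasurable.integral_kernel (κ := ρ.condKernel)
      (UnitAddTorus.mFourier ξ).continuous.stronglyMeasurable).measurable
    have hm1 : ∀ x, ‖m x‖ ≤ 1 := fun x => by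
      refine (norm_integral_le_of_norm_le_const (C := 1) (Eventually.of_forall fun y => ?_)).trans ?_
      · rw [norm_mFourier_apply]
      · simp
    have hψ : ∀ x, ‖S.indicator (1 : X → ℂ) x * m x‖ ≤ 1 := fun x => by
      by_cases hx : x ∈ S <;> simp [hx, hm1 x]
    refine (h ξ hξ _ (hSm.mul hm) hψ).congr fun t => ?_
    have hF : Integrable (S.indicator fun _ => UnitAddTorus.mFourier ξ) ρ.fst :=
      (integrable_const (UnitAddTorus.mFourier ξ)).indicator hS
    have hint := integrable_eval_fibre hF (measurable_translate hv t)
    simp only [hsplit] at hint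
    rw [← Measure.integral_condKernel hint]
    refine integral_congr_ae (Eventually.of_forall fun x => ?_)
    have hsum : ∑ i, (ξ i : ℝ) * (t • v x) i = t * ∑ i, (ξ i : ℝ) * v x i := by
      simp only [Pi.smul_apply, smul_eq_mul, mul_left_comm _ t, ← Finset.mul_sum]
    simp only [mFourier_apply_add, mFourier_torusProj, hsum, Pi.mul_apply, m]
    rw [integral_const_mul, integral_mul_const, mul_assoc]

/-- Translations with velocity `v` along the fibres of `X × 𝕋^d` spread any measure over the
fibres, when all the oscillating integrals of `v` tend to zero. -/
theorem tendsto_integral_translate [IsFiniteMeasure ρ] {v : X → (Fin d → ℝ)}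
    (h : ∀ ξ : Fin d → ℤ, ξ ≠ 0 → ∀ ψ : X → ℂ, Measurable ψ → (∀ x, ‖ψ x‖ ≤ 1) →
      Tendsto (fun t : ℝ => ∫ x, ψ x *
        Complex.exp (2 * Real.pi * Complex.I * (t * ∑ i, (ξ i : ℝ) * v x i : ℝ)) ∂ρ.fst)
        atTop (𝓝 0)) (hv : Measurable v) {F : X → C(Torus d, ℂ)} (hF : Integrable F ρ.fst) :
    Tendsto (fun t : ℝ => ∫ q, F q.1 (q.2 + torusProj (t • v q.1)) ∂ρ) atTop
      (𝓝 (∫ q, F q.1 q.2 ∂(ρ.fst.prod volume))) := by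
  have hfst : (ρ.fst.prod (volume : Measure (Torus d))).fst = ρ.fst := Measure.fst_prod
  have hi : ∀ {F : X → C(Torus d, ℂ)}, Integrable F ρ.fst → ∀ t : ℝ,
      Integrable (fun q => F q.1 (q.2 + torusProj (t • v q.1))) ρ := fun hF t =>
    integrable_eval_fibre hF (measurable_translate hv t)
  have hi' : ∀ {F : X → C(Torus d, ℂ)}, Integrable F ρ.fst →
      Integrable (fun q => F q.1 q.2) (ρ.fst.prod volume) := fun hF =>
    integrable_eval_fibre (by rwa [hfst]) measurable_snd
  have hn : ∀ {F : X → C(Torus d, ℂ)}, Integrable F ρ.fst → ∀ t : ℝ,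
      ‖∫ q, F q.1 (q.2 + torusProj (t • v q.1)) ∂ρ‖ ≤ ∫ x, ‖F x‖ ∂ρ.fst := fun hF t =>
    norm_integral_eval_fibre_le hF fun q => q.2 + torusProj (t • v q.1)
  have hn' : ∀ {F : X → C(Torus d, ℂ)}, Integrable F ρ.fst →
      ‖∫ q, F q.1 q.2 ∂(ρ.fst.prod (volume : Measure (Torus d)))‖ ≤ ∫ x, ‖F x‖ ∂ρ.fst :=
    fun hF => (norm_integral_eval_fibre_le (ρ := ρ.fst.prod (volume : Measure (Torus d)))
      (by rwa [hfst]) Prod.snd).trans_eq (by rw [hfst])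
  let T : ℝ → (X → C(Torus d, ℂ)) → ℂ := fun t F =>
    ∫ q, F q.1 (q.2 + torusProj (t • v q.1)) ∂ρ
  let L : (X → C(Torus d, ℂ)) → ℂ := fun F => ∫ q, F q.1 q.2 ∂(ρ.fst.prod volume)
  have hTadd : ∀ {F G : X → C(Torus d, ℂ)}, Integrable F ρ.fst → Integrable G ρ.fst → ∀ t,
      T t (F + G) = T t F + T t G := fun hF hG t => integral_add (hi hF t) (hi hG t)
  have hLadd : ∀ {F G : X → C(Torus d, ℂ)}, Integrable F ρ.fst → Integrable G ρ.fst →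
      L (F + G) = L F + L G := fun hF hG => integral_add (hi' hF) (hi' hG)
  have hTsub : ∀ {F G : X → C(Torus d, ℂ)}, Integrable F ρ.fst → Integrable G ρ.fst → ∀ t,
      T t F - T t G = T t (F - G) := fun hF hG t => (integral_sub (hi hF t) (hi hG t)).symm
  have hLsub : ∀ {F G : X → C(Torus d, ℂ)}, Integrable F ρ.fst → Integrable G ρ.fst →
      L F - L G = L (F - G) := fun hF hG => (integral_sub (hi' hF) (hi' hG)).symm
  have hTae : ∀ {F G : X → C(Torus d, ℂ)}, F =ᵐ[ρ.fst] G → ∀ t, T t F = T t G := by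
    intro F G hFG t
    refine integral_congr_ae ?_
    filter_upwards [ae_of_ae_map measurable_fst.aemeasurable hFG] with q hq
    rw [hq]
  have hLae : ∀ {F G : X → C(Torus d, ℂ)}, F =ᵐ[ρ.fst] G → L F = L G := by
    intro F G hFG
    refine integral_congr_ae ?_
    filter_upwards [Measure.quasiMeasurePreserving_fst.ae hFG] with q hq
    rw [hq]
  change Tendsto (fun t => T t F) atTop (𝓝 (L F))
  -- Both sides are additive and Lipschitz in `F` for the `L¹` norm, uniformly in `t`. This reduces
  -- to `F = 1_S c`, and density of trigonometric polynomials then reduces `c` to a character.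
  refine Integrable.induction (μ := ρ.fst) (fun F => Tendsto (fun t => T t F) atTop (𝓝 (L F)))
    (fun c S hS _ => ?_) (fun F G _ hF hG HF HG => ?_) ?_ (fun F G hFG _ HF => ?_) hF
  · have hci : ∀ c : C(Torus d, ℂ), Integrable (S.indicator fun _ => c) ρ.fst := fun c =>
      (integrable_const c).indicator hS
    have hcsub : ∀ a b : C(Torus d, ℂ), (S.indicator fun _ => a) - (S.indicator fun _ => b) =
        S.indicator fun _ => a - b := fun a b => (Set.indicator_sub S _ _).symm
    have hcn : ∀ a : C(Torus d, ℂ), ∫ x, ‖S.indicator (fun _ => a) x‖ ∂ρ.fst ≤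
        ρ.fst.real univ * ‖a‖ := by
      intro a
      refine (integral_mono (hci a).norm (integrable_const ‖a‖) fun x => ?_).trans_eq (by simp)
      exact norm_indicator_le_norm_self (fun _ => a) x
    have hK : (0 : ℝ) ≤ ρ.fst.real univ := measureReal_nonneg
    have hclosed : IsClosed {c : C(Torus d, ℂ) | Tendsto (fun t => T t (S.indicator fun _ => c))
        atTop (𝓝 (L (S.indicator fun _ => c)))} := by
      refine Equicontinuous.isClosed_setOfPred_tendsto
        (F := fun t (c : C(Torus d, ℂ)) => T t (S.indicator fun _ => c))
        (UniformEquicontinuous.equicontinuous ?_) ?_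
      · refine LipschitzWith.uniformEquicontinuous _ ⟨_, hK⟩ fun t =>
          LipschitzWith.of_dist_le_mul fun a b => ?_
        rw [dist_eq_norm, dist_eq_norm, hTsub (hci a) (hci b), hcsub]
        exact (hn (hci _) t).trans (hcn _)
      · refine (LipschitzWith.of_dist_le_mul (K := ⟨_, hK⟩) fun a b => ?_).continuous
        rw [dist_eq_norm, dist_eq_norm, hLsub (hci a) (hci b), hcsub]
        exact (hn' (hci _)).trans (hcn _)
    have hc : c ∈ closure (Submodule.span ℂ (range (UnitAddTorus.mFourier (d := Fin d))) :
        Set C(Torus d, ℂ)) := by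
      rw [← Submodule.topologicalClosure_coe, UnitAddTorus.span_mFourier_closure_eq_top]
      trivial
    refine closure_minimal (fun a ha => ?_) hclosed hc
    induction ha using Submodule.span_induction with
    | mem a ha =>
      obtain ⟨ξ, rfl⟩ := ha
      exact tendsto_integral_indicator_mFourier h hv hS ξ
    | zero => simp [T, L]
    | add a b _ _ ha hb =>
      have hab : (S.indicator fun _ => a + b) =
          (S.indicator fun _ => a) + (S.indicator fun _ => b) := Set.indicator_add S _ _
      simp only [mem_ofPred_eq, hab, hTadd (hci a) (hci b), hLadd (hci a) (hci b)] at ha hb ⊢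
      exact ha.add hb
    | smul r a _ ha =>
      have hra : ∀ (x : X) (y : Torus d), S.indicator (fun _ => r • a) x y =
          r * S.indicator (fun _ => a) x y := fun x y => by
        by_cases hx : x ∈ S <;> simp [hx]
      simp only [mem_ofPred_eq, T, L, hra, integral_const_mul] at ha ⊢
      exact ha.const_mul r
  · simp only [hTadd hF hG, hLadd hF hG]
    exact HF.add HG
  · refine Equicontinuous.isClosed_setOfPred_tendsto
      (F := fun t (F : X →₁[ρ.fst] C(Torus d, ℂ)) => T t F)
      (UniformEquicontinuous.equicontinuous ?_) ?_
    · refine LipschitzWith.uniformEquicontinuous _ 1 fun t =>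
        LipschitzWith.of_dist_le_mul fun F G => ?_
      rw [dist_eq_norm, dist_eq_norm, hTsub (L1.integrable_coeFn F) (L1.integrable_coeFn G),
        ← hTae (Lp.coeFn_sub F G), NNReal.coe_one, one_mul, L1.norm_eq_integral_norm]
      exact hn (L1.integrable_coeFn _) t
    · refine (LipschitzWith.of_dist_le_mul (K := 1) fun F G => ?_).continuous
      rw [dist_eq_norm, dist_eq_norm, hLsub (L1.integrable_coeFn F) (L1.integrable_coeFn G),
        ← hLae (Lp.coeFn_sub F G), NNReal.coe_one, one_mul, L1.norm_eq_integral_norm]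
      exact hn' (L1.integrable_coeFn _)
  · rw [← hLae hFG]
    exact HF.congr fun t => hTae hFG t

end Translate

/-! ### Convergence from Keplerian shear -/

section FibreMap

variable {d : ℕ} {M Ω : Type*} [TopologicalSpace M] [TopologicalSpace Ω] {π : Ω → M}

theorem continuousOn_symm_comp (e : Bundle.Trivialization (Torus d) π) (f : C(Ω, ℂ)) :
    ContinuousOn (fun q : M × Torus d => f (e.toOpenPartialHomeomorph.symm q))
      (e.baseSet ×ˢ univ) := by
  rw [← e.target_eq]
  exact f.continuous.comp_continuousOn e.continuousOn_invFun

open Classical in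
/-- The restrictions of a continuous function to the fibres over a chart, as a map to `C(𝕋^d)`. -/
def fibreMap (e : Bundle.Trivialization (Torus d) π) (f : C(Ω, ℂ)) (x : M) : C(Torus d, ℂ) :=
  if hx : x ∈ e.baseSet then
    ⟨fun y => f (e.toOpenPartialHomeomorph.symm (x, y)),
      (continuousOn_symm_comp e f).comp_continuous (by fun_prop) fun _ => ⟨hx, mem_univ _⟩⟩
  else 0

theorem fibreMap_apply (e : Bundle.Trivialization (Torus d) π) (f : C(Ω, ℂ)) {x : M}
    (hx : x ∈ e.baseSet) (y : Torus d) :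
    fibreMap e f x y = f (e.toOpenPartialHomeomorph.symm (x, y)) := by
  rw [fibreMap, dif_pos hx]
  rfl

theorem fibreMap_chartCoord (e : Bundle.Trivialization (Torus d) π) (f : C(Ω, ℂ)) {p : Ω}
    (hp : π p ∈ e.baseSet) : fibreMap e f (π p) (chartCoord e p).2 = f p := by
  rw [fibreMap_apply e f hp, show (π p, (chartCoord e p).2) = chartCoord e p from rfl,
    chartCoord_eq e hp]
  exact congrArg f (e.toOpenPartialHomeomorph.left_inv (e.mem_source.2 hp))

/-- Currying: a jointly continuous function on `U × 𝕋^d` is a continuous map from `U` to `C(𝕋^d)`.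
-/
theorem continuousOn_fibreMap (e : Bundle.Trivialization (Torus d) π) (f : C(Ω, ℂ)) :
    ContinuousOn (fibreMap e f) e.baseSet := by
  rw [continuousOn_iff_continuous_domRestrict]
  refine ContinuousMap.continuous_of_continuous_uncurry _ ?_
  have h : Continuous fun q : e.baseSet × Torus d =>
      f (e.toOpenPartialHomeomorph.symm ((q.1 : M), q.2)) :=
    (continuousOn_symm_comp e f).comp_continuous (by fun_prop) fun q => ⟨q.1.2, mem_univ _⟩
  refine h.congr fun q => ?_
  exact (fibreMap_apply e f q.1.2 q.2).symm

theorem norm_fibreMap_le [CompactSpace Ω] (e : Bundle.Trivialization (Torus d) π) (f : C(Ω, ℂ))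
    (x : M) : ‖fibreMap e f x‖ ≤ ‖f‖ := by
  refine (ContinuousMap.norm_le _ (norm_nonneg f)).2 fun y => ?_
  by_cases hx : x ∈ e.baseSet
  · rw [fibreMap_apply e f hx]
    exact f.norm_coe_le_norm _
  · rw [fibreMap, dif_neg hx]
    simp

theorem integrable_fibreMap [CompactSpace Ω] [MeasurableSpace M] [BorelSpace M]
    (e : Bundle.Trivialization (Torus d) π) (f : C(Ω, ℂ)) {A : Set M} (hA : MeasurableSet A)
    (hAe : A ⊆ e.baseSet) (ν : Measure M) [IsFiniteMeasure ν] :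
    Integrable (fibreMap e f) (ν.restrict A) :=
  Integrable.of_bound (((continuousOn_fibreMap e f).mono hAe).aestronglyMeasurable hA) ‖f‖
    (Eventually.of_forall (norm_fibreMap_le e f))

end FibreMap

namespace AffineToriBundle

variable {n d : ℕ} {M Ω : Type*}
  [TopologicalSpace M] [ChartedSpace (EuclideanSpace ℝ (Fin n)) M]
  [MeasurableSpace M] [BorelSpace M]
  [TopologicalSpace Ω] [ChartedSpace (EuclideanSpace ℝ (Fin (n + d))) Ω]
  [MeasurableSpace Ω] [BorelSpace Ω]
  {π : Ω → M} {B : AffineToriBundle n d π} {g : Flow ℝ Ω}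

/-- Keplerian shear and irrationality make the oscillating integrals of the velocity vanish. -/
theorem tendsto_oscillating_integral
    {ν : ProbabilityMeasure M} {νLeb : ProbabilityMeasure Ω} (hν : νLeb ∈ prescribedMarginal π ν)
    (hks : KeplerianShear (νLeb : Measure Ω) (fun t => g t))
    (hirr : ∀ᵐ x ∂(ν : Measure M), B.IsIrrationalAt g x)
    {e : Bundle.Trivialization (Torus d) π} (he : e ∈ B.atlas) {v : M → (Fin d → ℝ)}
    (hg : B.IsCompatibleFlow g) (hvm : Measurable v) (hv : IsCompatibleOnWith e g v)
    {A : Set M} (hA : MeasurableSet A) (hAe : A ⊆ e.baseSet) {ξ : Fin d → ℤ} (hξ : ξ ≠ 0)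
    {ψ : M → ℂ} (hψ : Measurable ψ) (hψb : ∀ x, ‖ψ x‖ ≤ 1) :
    Tendsto (fun t : ℝ => ∫ x in A, ψ x *
      Complex.exp (2 * Real.pi * Complex.I * (t * ∑ i, (ξ i : ℝ) * v x i : ℝ)) ∂(ν : Measure M))
      atTop (𝓝 0) := by
  have hπ := B.measurable_proj
  have hνm : (νLeb : Measure Ω).map π = (ν : Measure M) := hν
  set w : M → ℝ := fun x => ∑ i, (ξ i : ℝ) * v x i
  have hwm : Measurable w :=
    Finset.measurable_fun_sum _ fun i _ => measurable_const.mul ((measurable_pi_apply i).comp hvm)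
  set f : Ω → ℂ := (π ⁻¹' A).indicator fun p => UnitAddTorus.mFourier ξ (chartCoord e p).2
  have hχm : Measurable fun p => UnitAddTorus.mFourier ξ (chartCoord e p).2 :=
    (UnitAddTorus.mFourier ξ).continuous.measurable.comp
      (measurable_snd.comp (measurable_chartCoord hπ e))
  have hfm : Measurable f := hχm.indicator (hπ hA)
  have hfb : ∀ p, ‖f p‖ ≤ 1 := fun p =>
    (norm_indicator_le_norm_self _ p).trans_eq (norm_mFourier_apply ξ _)
  have hfg : ∀ (t : ℝ) p, f (g t p) =
      Complex.exp (2 * Real.pi * Complex.I * (t * w (π p) : ℝ)) * f p := by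
    intro t p
    by_cases hp : π p ∈ A
    · have hp1 : p ∈ π ⁻¹' A := hp
      have hp2 : g t p ∈ π ⁻¹' A := by rw [mem_preimage, hg.proj_apply t p]; exact hp
      have hsum : ∑ i, (ξ i : ℝ) * (t • v (π p)) i = t * w (π p) := by
        simp only [w, Pi.smul_apply, smul_eq_mul, mul_left_comm _ t, ← Finset.mul_sum]
      simp only [f, indicator_of_mem hp1, indicator_of_mem hp2, hv.chartCoord_apply t (hAe hp),
        mFourier_apply_add, mFourier_torusProj, hsum]
      ring
    · have hp1 : p ∉ π ⁻¹' A := hp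
      have hp2 : g t p ∉ π ⁻¹' A := by rw [mem_preimage, hg.proj_apply t p]; exact hp
      simp only [f, indicator_of_notMem hp1, indicator_of_notMem hp2, mul_zero]
  have hw0 : ∀ᵐ p ∂(νLeb : Measure Ω), f p ≠ 0 → w (π p) ≠ 0 := by
    rw [← hνm] at hirr
    filter_upwards [ae_of_ae_map hπ.aemeasurable hirr] with p hp hfp
    have hpA : p ∈ π ⁻¹' A := by
      by_contra h
      exact hfp (indicator_of_notMem h _)
    exact hp e he (hAe hpA) v hv ξ hξ
  -- With this choice `conj z · f = ψ |f|²`, which is `ψ` over `A` and zero elsewhere, so the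
  -- correlation becomes the integral over the base.
  set z : Ω → ℂ := fun p => starRingEnd ℂ (ψ (π p)) * f p
  have hz : MemLp z 2 (νLeb : Measure Ω) := by
    refine MemLp.of_bound (((Complex.continuous_conj.measurable.comp
      (hψ.comp hπ)).mul hfm).aestronglyMeasurable) 1 (Eventually.of_forall fun p => ?_)
    rw [norm_mul, RCLike.norm_conj]
    exact mul_le_one₀ (hψb _) (norm_nonneg _) (hfb p)
  refine (hks.tendsto_integral_eigenfunction hfm hfb (hwm.comp hπ) hfg hw0 hz
    fun p hp => by simp [z, hp]).congr fun t => ?_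
  set H : M → ℂ := fun x => ψ x * Complex.exp (2 * Real.pi * Complex.I * (t * w x : ℝ))
  have hH : Measurable H := hψ.mul (Complex.measurable_exp.comp
    (measurable_const.mul (Complex.measurable_ofReal.comp (measurable_const.mul hwm))))
  have h1 : ∫ x in A, H x ∂(ν : Measure M) = ∫ p in π ⁻¹' A, H (π p) ∂(νLeb : Measure Ω) := by
    rw [← hνm]
    exact setIntegral_map hA hH.aestronglyMeasurable hπ.aemeasurable
  change _ = ∫ x in A, H x ∂(ν : Measure M)
  rw [h1, ← integral_indicator (hπ hA)]
  refine integral_congr_ae (Eventually.of_forall fun p => ?_)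
  by_cases hp : p ∈ π ⁻¹' A
  · have h2 : starRingEnd ℂ (f p) * f p = 1 := by
      rw [mul_comm, Complex.mul_conj, Complex.normSq_eq_norm_sq,
        show ‖f p‖ = 1 by simp only [f, indicator_of_mem hp, norm_mFourier_apply]]
      simp
    simp only [indicator_of_mem hp, z, H, map_mul, Complex.conj_conj, Function.comp_apply]
    linear_combination (ψ (π p) * Complex.exp (2 * Real.pi * Complex.I * (t * w (π p) : ℝ))) * h2
  · simp [indicator_of_notMem hp, z, f]

/-- In the chart, `μ` over `A` becomes a measure on `M × 𝕋^d` with first marginal `ν|A`, and the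
flow becomes translation along the fibres; the compatible measure becomes the product. -/
theorem tendsto_setIntegral_chart [CompactSpace Ω]
    {ν : ProbabilityMeasure M} {νLeb : ProbabilityMeasure Ω} (hν : νLeb ∈ prescribedMarginal π ν)
    (hc : B.IsCompatibleMeasure (νLeb : Measure Ω)) (hg : B.IsCompatibleFlow g)
    (hks : KeplerianShear (νLeb : Measure Ω) (fun t => g t))
    (hirr : ∀ᵐ x ∂(ν : Measure M), B.IsIrrationalAt g x)
    {e : Bundle.Trivialization (Torus d) π} (he : e ∈ B.atlas)
    {A : Set M} (hA : MeasurableSet A) (hAe : A ⊆ e.baseSet)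
    {μ : ProbabilityMeasure Ω} (hμ : μ ∈ prescribedMarginal π ν) (f : C(Ω, ℂ)) :
    Tendsto (fun t : ℝ => ∫ p in π ⁻¹' A, f (g t p) ∂(μ : Measure Ω)) atTop
      (𝓝 (∫ p in π ⁻¹' A, f p ∂(νLeb : Measure Ω))) := by
  have hπ := B.measurable_proj
  have hcm := measurable_chartCoord hπ e
  obtain ⟨v, hvm, hv⟩ := hg.exists_measurable_velocity he
  set ρ : Measure (M × Torus d) := ((μ : Measure Ω).restrict (π ⁻¹' A)).map (chartCoord e)
  have hρ : ρ.fst = (ν : Measure M).restrict A := by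
    rw [← (hμ : (μ : Measure Ω).map π = (ν : Measure M)), Measure.restrict_map hπ hA,
      Measure.fst, Measure.map_map measurable_fst hcm]
    rfl
  have hF : Integrable (fibreMap e f) ρ.fst := by
    rw [hρ]
    exact integrable_fibreMap e f hA hAe _
  have h := tendsto_integral_translate (ρ := ρ) (v := v) (fun ξ hξ ψ hψ hψb => by
    rw [hρ]
    exact tendsto_oscillating_integral hν hks hirr he hg hvm hv hA hAe hξ hψ hψb) hvm hF
  have hl : ∫ q, fibreMap e f q.1 q.2 ∂(ρ.fst.prod volume) =
      ∫ p in π ⁻¹' A, f p ∂(νLeb : Measure Ω) := by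
    have hi : Integrable (fun q : M × Torus d => fibreMap e f q.1 q.2) (ρ.fst.prod volume) :=
      integrable_eval_fibre (by rwa [Measure.fst_prod]) measurable_snd
    have h2 := hc.map_chartCoord he hA hAe
    rw [(hν : (νLeb : Measure Ω).map π = (ν : Measure M)), ← hρ] at h2
    rw [← h2] at hi ⊢
    rw [integral_map hcm.aemeasurable hi.aestronglyMeasurable]
    exact setIntegral_congr_fun (hπ hA) fun p hp => fibreMap_chartCoord e f (hAe hp)
  rw [hl] at h
  refine h.congr fun t => ?_
  rw [integral_map hcm.aemeasurable
    (integrable_eval_fibre hF (measurable_translate hvm t)).aestronglyMeasurable]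
  refine setIntegral_congr_fun (hπ hA) fun p hp => ?_
  have h3 := fibreMap_chartCoord e f (p := g t p) (by rw [hg.proj_apply t p]; exact hAe hp)
  rw [hv.chartCoord_apply t (hAe hp), hg.proj_apply t p] at h3
  exact h3

theorem tendsto_flowPush [CompactSpace Ω]
    {ν : ProbabilityMeasure M} {νLeb : ProbabilityMeasure Ω} (hν : νLeb ∈ prescribedMarginal π ν)
    (hc : B.IsCompatibleMeasure (νLeb : Measure Ω)) (hg : B.IsCompatibleFlow g)
    (hks : KeplerianShear (νLeb : Measure Ω) (fun t => g t))
    (hirr : ∀ᵐ x ∂(ν : Measure M), B.IsIrrationalAt g x)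
    {μ : ProbabilityMeasure Ω} (hμ : μ ∈ prescribedMarginal π ν) :
    Tendsto (fun t : ℝ => flowPush g t μ) atTop (𝓝 νLeb) := by
  have := B.compactSpace_base
  have hπ := B.measurable_proj
  obtain ⟨N, e, D, he, hD, hDe, hDd, hDu⟩ := B.exists_finite_partition
  rw [ProbabilityMeasure.tendsto_iff_forall_integral_rclike_tendsto ℂ]
  intro F
  have hgt : ∀ t : ℝ, Continuous (g t) := fun t => g.continuous continuous_const continuous_id
  have hu : ⋃ i, π ⁻¹' D i = univ := by rw [← preimage_iUnion, hDu, preimage_univ]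
  have hdis : Pairwise (Function.onFun Disjoint fun i => π ⁻¹' D i) := fun i j hij =>
    (hDd hij).preimage π
  have hsum : ∀ (m : ProbabilityMeasure Ω) (f : C(Ω, ℂ)), ∫ p, f p ∂(m : Measure Ω) =
      ∑ i, ∫ p in π ⁻¹' D i, f p ∂(m : Measure Ω) := by
    intro m f
    have hi : Integrable f (m : Measure Ω) :=
      (BoundedContinuousFunction.mkOfCompact f).integrable _
    rw [← setIntegral_univ, ← hu]
    exact integral_iUnion_fintype (fun i => hπ (hD i)) hdis fun i => hi.integrableOn
  have h1 : ∀ t : ℝ, ∫ p, F p ∂(flowPush g t μ : Measure Ω) =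
      ∑ i, ∫ p in π ⁻¹' D i, F (g t p) ∂(μ : Measure Ω) := fun t =>
    (integral_map (hgt t).measurable.aemeasurable
      F.continuous.measurable.aestronglyMeasurable).trans
      (hsum μ (F.toContinuousMap.comp ⟨g t, hgt t⟩))
  simp only [h1]
  rw [show ∫ p, F p ∂(νLeb : Measure Ω) = _ from hsum νLeb F.toContinuousMap]
  exact tendsto_finsetSum _ fun i _ => tendsto_setIntegral_chart hν hc hg hks hirr (he i) (hD i)
    (hDe i) hμ F.toContinuousMap

end AffineToriBundle

end

theorem mainTheorem3 {n d : ℕ} (hn : 1 ≤ n) (hd : 1 ≤ d) {M Ω : Type*}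
    [TopologicalSpace M] [T2Space M] [SecondCountableTopology M]
    [ChartedSpace (EuclideanSpace ℝ (Fin n)) M] [IsManifold (𝓡 n) 1 M]
    [MeasurableSpace M] [BorelSpace M]
    [TopologicalSpace Ω] [T2Space Ω] [SecondCountableTopology Ω] [CompactSpace Ω]
    [ChartedSpace (EuclideanSpace ℝ (Fin (n + d))) Ω] [IsManifold (𝓡 (n + d)) 1 Ω]
    [MeasurableSpace Ω] [BorelSpace Ω]
    {π : Ω → M} (B : AffineToriBundle n d π)
    (g : Flow ℝ Ω) (hg : B.IsCompatibleFlow g) (ν : ProbabilityMeasure M) :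
    -- the measure `ν ⊗ Leb` is well defined
    (∃! νLeb : ProbabilityMeasure Ω,
      νLeb ∈ prescribedMarginal π ν ∧ B.IsCompatibleMeasure (νLeb : Measure Ω)) ∧
    ∀ νLeb : ProbabilityMeasure Ω,
      νLeb ∈ prescribedMarginal π ν → B.IsCompatibleMeasure (νLeb : Measure Ω) →
      ((KeplerianShear (νLeb : Measure Ω) (fun t => g t) ∧
          ∀ᵐ x ∂(ν : Measure M), B.IsIrrationalAt g x) ↔
        ∀ μ ∈ prescribedMarginal π ν,
          Tendsto (fun t : ℝ => flowPush g t μ) atTop (𝓝 νLeb)) ∧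
      ((∀ μ ∈ prescribedMarginal π ν,
          Tendsto (fun t : ℝ => flowPush g t μ) atTop (𝓝 νLeb)) →
        IsUniquelyErgodic (AffineToriBundle.actionOnMarginal hg ν)) := by
  have := B.compactSpace_base
  refine ⟨B.existsUnique_isCompatibleMeasure ν, fun νLeb hν hc => ⟨⟨?_, fun hlim => ?_⟩,
    fun hlim => ?_⟩⟩
  · rintro ⟨hks, hirr⟩ μ hμ
    exact AffineToriBundle.tendsto_flowPush hν hc hg hks hirr hμ
  · exact ⟨keplerianShear_of_tendsto B.measurable_proj hg.proj_apply hν hlim,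
      AffineToriBundle.ae_isIrrationalAt hg hν hc hlim⟩
  · refine isUniquelyErgodic_of_tendsto (x₀ := ⟨νLeb, hν⟩) (fun t => ?_) (fun t => ?_) fun μ => ?_
    · exact (continuous_flowPush t).restrict (hg.mapsTo ν t)
    · exact Subtype.ext (flowPush_eq_of_tendsto (hlim νLeb hν) t)
    · exact tendsto_subtype_rng.2 (hlim μ μ.2)
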